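/- **Setting.** Let $T$ be a raw type theory over a signature $\Sigma$ of type and term symbols with finite arities (each argument of a symbol has a class $\mathsf{Ty},\mathsf{Tm},\mathsf{EqTy},\mathsf{EqTm}$ and binds finitely many variables). *Boundary theses* $b$ are $\Box\ \mathsf{type}$, $\Box : A$ (object boundaries), $A\equiv B\ \mathsf{by}\ \Box$ and $s\equiv t:A\ \mathsf{by}\ \Box$ (equation boundaries); a *boundary* $\mathcal B=\{x_1{:}A_1\}\cdots\{x_k{:}A_k\}\,b$ is an abstracted boundary thesis. Filling the placeholder of $\mathcal B$ with a head $e$ of the same arity (class and number of bound variables) gives a judgement $\mathcal B[e]$; the head of an equation is the dummy value $\star$. For an object boundary, $\mathcal B[e\equiv e']$ is the abstracted equation with $(\Box\ \mathsf{type})[A\equiv B]=(A\equiv B\ \mathsf{by}\ \star)$ and $(\Box : C)[s\equiv t]=(s\equiv t:C\ \mathsf{by}\ \star)$. A metavariable context $\Theta=[\mathsf M_1{:}\mathcal B_1,\dots,\mathsf M_n{:}\mathcal B_n]$ assigns closed boundaries to distinct metavariables, $\mathcal B_i$ mentioning only $\mathsf M_1,\dots,\mathsf M_{i-1}$; a variable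 context $\Gamma$ over $\Theta$ assigns types to distinct free variables, each type mentioning only earlier ones. A *raw rule* $\Xi\Longrightarrow b[e]$ consists of a metavariable context $\Xi$ (its premises) and a non-abstracted judgement $b[e]$ over $\Xi$ without free variables; it is an *object rule* if $b$ is an object boundary. An *instantiation* $I$ of $\Xi=[\mathsf M_1{:}\mathcal B_1,\dots,\mathsf M_n{:}\mathcal B_n]$ over $\Theta;\Gamma$ assigns to each $\mathsf M_i$ an argument over $\Theta;\Gamma$ of the arity of $\mathcal B_i$; it acts by $I_*(\mathsf M_i(t_1,\dots,t_k))=f[I_*t_1/x_1,\dots,I_*t_k/x_k]$ if $I(\mathsf M_i)=\{x_1\}\cdots\{x_k\}f$, and homomorphically otherwise, and $I_{(i)}$ is its restriction to $\mathsf M_1,\dots,\mathsf M_{i-1}$. A *raw type theory* $T$ is a family of raw rules. Derivability $\Theta;\Gamma\vdash_T\cdot$ of (syntactically valid) judgements and boundaries is generated by: the variable rule; metavariable application (with premises typing the arguments and deriving the instantiated boundary) and its congruence; abstraction; reflexivity, symmetry, transitivity of both equalities and conversion of terms and term equations along type equality; the rules stating when a boundary is well formed; for each rule $\Xi\Longrightarrow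 b[e]$ of $T$ and each instantiation $I$ with $I(\mathsf M_i)=f_i$, the closure rule with premises $(I_{(i)*}\mathcal B_i)[f_i]$ for all $i$ and $I_*b$, and conclusion $I_*(b[e])$; and for each object rule of $T$ and instantiations $I,J$ with values $f_i,g_i$, the congruence rule with premises $(I_{(i)*}\mathcal B_i)[f_i]$ and $(J_{(i)*}\mathcal B_i)[g_i]$ for all $i$, $(I_{(i)*}\mathcal B_i)[f_i\equiv g_i]$ for object boundaries $\mathcal B_i$, and $I_*B\equiv J_*B$ if $b=(\Box:B)$, and conclusion $(I_*b)[I_*e\equiv J_*e]$. Write $\vdash_T\Theta\ \mathsf{mctx}$ if each boundary of $\Theta$ is derivable over the preceding part of $\Theta$ (and the empty variable context), and $\Theta\vdash_T\Gamma\ \mathsf{vctx}$ if each type of $\Gamma$ is derivably a type over $\Theta$ and the preceding part of $\Gamma$. A raw rule $\Xi\Longrightarrow b[e]$ is *finitary over* $T$ if $\vdash_T\Xi\ \mathsf{mctx}$ and $\Xi;[\,]\vdash_T b$. The raw type theory $T=(R_i)_{i\in K}$ is a *finitary type theory* if $K$ has a well-founded (irreflexive, transitive) order $\prec$ such that each $R_i$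 is finitary over $(R_j)_{j\prec i}$. **Proposition (economic version of congruence rules).** Let $T$ be a finitary type theory and let $R=(\mathsf M_1{:}\mathcal B_1,\dots,\mathsf M_n{:}\mathcal B_n\Longrightarrow b[e])$ be one of its object rules. Let $\Theta;\Gamma$ be a context with $\vdash_T\Theta\ \mathsf{mctx}$ and $\Theta\vdash_T\Gamma\ \mathsf{vctx}$, and let $I=\langle\mathsf M_1\mapsto f_1,\dots,\mathsf M_n\mapsto f_n\rangle$ and $J=\langle\mathsf M_1\mapsto g_1,\dots,\mathsf M_n\mapsto g_n\rangle$ be instantiations of the premises of $R$ over $\Theta;\Gamma$. Then the closure rule $$\frac{\begin{array}{ll}\Theta;\Gamma\vdash (I_{(i)*}\mathcal B_i)[f_i] & \text{for each equation boundary }\mathcal B_i\\ \Theta;\Gamma\vdash (I_{(i)*}\mathcal B_i)[f_i\equiv g_i] & \text{for each object boundary }\mathcal B_i\end{array}}{\Theta;\Gamma\vdash (I_*b)[I_*e\equiv J_*e]}$$ is admissible: if all its premises are derivable in $T$, then so is its conclusion. -/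

import Mathlib

universe u v

namespace FTT

/-! ## Arities and signatures -/

/-- The two kinds of objects: types and terms. -/
inductive Kind
  | ty
  | tm

/-- The four syntactic classes: `obj ty`, `obj tm` are the classes of type and of term
expressions, `eqn ty`, `eqn tm` those of type and of term equations. -/
inductive Cls
  | obj (o : Kind)
  | eqn (o : Kind)

/-- A signature: the symbols of each class `Ty`, `Tm`, and the arity of each symbol, i.e. the
number of its arguments, and for each argument its class and the number of variables it binds. -/
structure Signature where
  Sym : Kind → Type u
  arity : {o : Kind} → Sym o → ℕ
  argCls : {o : Kind} → (s : Sym o) → Fin (arity s) → Cls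
  argBind : {o : Kind} → (s : Sym o) → Fin (arity s) → ℕ

/-! ## Expressions

Free variables are names in `ℕ`. Bound variables are nameless: an expression in the scope of
`x_0, ..., x_{n-1}` (outermost binder first) refers to `x_i` by `i : Fin n`, so that expressions
equal up to names of bound variables are equal. A metavariable is determined by its arity
`(c, k)` and a name in `ℕ`; thus there are infinitely many metavariables of each arity.
Symbol and metavariable arities are respected by construction. -/

/-- `Expr S c n`: the expressions of class `c` in the scope of `n` bound variables. An argument
`{x_0} ⋯ {x_{k-1}} e` of arity `(c, k)`, without further bound variables, is an element of
`Expr S c k`. -/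
inductive Expr (S : Signature.{u}) : Cls → ℕ → Type u
  | bvar {n : ℕ} (i : Fin n) : Expr S (.obj .tm) n
  | fvar {n : ℕ} (a : ℕ) : Expr S (.obj .tm) n
  | symb {n : ℕ} {o : Kind} (s : S.Sym o)
      (es : ∀ i : Fin (S.arity s), Expr S (S.argCls s i) (n + S.argBind s i)) : Expr S (.obj o) n
  | mvar {n : ℕ} {o : Kind} {k : ℕ} (M : ℕ) (ts : Fin k → Expr S (.obj .tm) n) : Expr S (.obj o) n
  | dummy {n : ℕ} (o : Kind) : Expr S (.eqn o) n

/-- Type expressions. -/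
abbrev TyExpr (S : Signature.{u}) (n : ℕ) := Expr S (.obj .ty) n

/-- Term expressions. -/
abbrev TmExpr (S : Signature.{u}) (n : ℕ) := Expr S (.obj .tm) n

variable {S : Signature.{u}}

/-- Extend a renaming of bound variables under `b` binders. -/
def liftRen {n m : ℕ} (ρ : Fin n → Fin m) (b : ℕ) : Fin (n + b) → Fin (m + b) :=
  Fin.addCases (fun i => Fin.castAdd b (ρ i)) (fun j => Fin.natAdd m j)

/-- Renaming of bound variables. -/
def Expr.rename {c : Cls} {n m : ℕ} (ρ : Fin n → Fin m) : Expr S c n → Expr S c m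
  | .bvar i => .bvar (ρ i)
  | .fvar a => .fvar a
  | .symb s es => .symb s fun i => (es i).rename (liftRen ρ (S.argBind s i))
  | .mvar M ts => .mvar M fun j => (ts j).rename ρ
  | .dummy o => .dummy o

/-- Extend a substitution for bound variables under `b` binders. -/
def liftSub {n m : ℕ} (σ : Fin n → TmExpr S m) (b : ℕ) : Fin (n + b) → TmExpr S (m + b) :=
  Fin.addCases (fun i => (σ i).rename (Fin.castAdd b)) (fun j => .bvar (Fin.natAdd m j))

/-- Parallel capture-avoiding substitution `e[σ_0/x_0, ..., σ_{n-1}/x_{n-1}]`. -/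
def Expr.subst {c : Cls} {n m : ℕ} (σ : Fin n → TmExpr S m) : Expr S c n → Expr S c m
  | .bvar i => σ i
  | .fvar a => .fvar a
  | .symb s es => .symb s fun i => (es i).subst (liftSub σ (S.argBind s i))
  | .mvar M ts => .mvar M fun j => (ts j).subst σ
  | .dummy o => .dummy o

/-- `e[a/x_0]`: replace the outermost bound variable by the free variable `a`. -/
def Expr.openVar {c : Cls} {n : ℕ} (a : ℕ) (e : Expr S c (n + 1)) : Expr S c n :=
  e.subst (Fin.cases (.fvar a) .bvar)

/-- The free variables of `e` satisfy `V` and its metavariables (given by class, number of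
arguments, name) satisfy `P`. -/
def Expr.Over (P : Cls → ℕ → ℕ → Prop) (V : ℕ → Prop) {c : Cls} {n : ℕ} : Expr S c n → Prop
  | .bvar _ => True
  | .fvar a => V a
  | .symb _ es => ∀ i, (es i).Over P V
  | .mvar (o := o) (k := k) M ts => P (.obj o) k M ∧ ∀ j, (ts j).Over P V
  | .dummy _ => True

/-- An instantiation assigns to each metavariable of arity `(c, k)` an argument of arity `(c, k)`.
An instantiation of a metavariable context `Ξ` is given by such a map, of which only the values
at the metavariables of `Ξ` matter, see `Inst.Valid`. -/
abbrev Inst (S : Signature.{u}) := (c : Cls) → (k : ℕ) → ℕ → Expr S c k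

/-- The action of an instantiation on expressions,
`I (M (t_1, ..., t_k)) = e [I t_1 / x_1, ..., I t_k / x_k]` where `I M = {x_1} ⋯ {x_k} e`. -/
def Expr.inst (I : Inst S) {c : Cls} {n : ℕ} : Expr S c n → Expr S c n
  | .bvar i => .bvar i
  | .fvar a => .fvar a
  | .symb s es => .symb s fun i => (es i).inst I
  | .mvar (o := o) (k := k) M ts => (I (.obj o) k M).subst fun j => (ts j).inst I
  | .dummy o => .dummy o

/-- The application `M(t_1, ..., t_k)` of a metavariable; it is `⋆` when `M` is an equality
metavariable. -/
def mvarApp {n : ℕ} : (c : Cls) → {k : ℕ} → ℕ → (Fin k → TmExpr S n) → Expr S c n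
  | .obj _, _, M, ts => .mvar M ts
  | .eqn o, _, _, _ => .dummy o

/-! ## Boundaries and judgements -/

/-- Boundary theses: `□ type`, `□ : A`, `A ≡ B by □`, `s ≡ t : A by □`. -/
inductive BdryThesis (S : Signature.{u}) : Cls → ℕ → Type u
  | isTy {n : ℕ} : BdryThesis S (.obj .ty) n
  | ofTy {n : ℕ} (A : TyExpr S n) : BdryThesis S (.obj .tm) n
  | eqTy {n : ℕ} (A B : TyExpr S n) : BdryThesis S (.eqn .ty) n
  | eqTm {n : ℕ} (s t : TmExpr S n) (A : TyExpr S n) : BdryThesis S (.eqn .tm) n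

namespace BdryThesis

def subst {c : Cls} {n m : ℕ} (σ : Fin n → TmExpr S m) : BdryThesis S c n → BdryThesis S c m
  | .isTy => .isTy
  | .ofTy A => .ofTy (A.subst σ)
  | .eqTy A B => .eqTy (A.subst σ) (B.subst σ)
  | .eqTm s t A => .eqTm (s.subst σ) (t.subst σ) (A.subst σ)

def openVar {c : Cls} {n : ℕ} (a : ℕ) (b : BdryThesis S c (n + 1)) : BdryThesis S c n :=
  b.subst (Fin.cases (.fvar a) .bvar)

def inst (I : Inst S) {c : Cls} {n : ℕ} : BdryThesis S c n → BdryThesis S c n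
  | .isTy => .isTy
  | .ofTy A => .ofTy (A.inst I)
  | .eqTy A B => .eqTy (A.inst I) (B.inst I)
  | .eqTm s t A => .eqTm (s.inst I) (t.inst I) (A.inst I)

def Over (P : Cls → ℕ → ℕ → Prop) (V : ℕ → Prop) {c : Cls} {n : ℕ} : BdryThesis S c n → Prop
  | .isTy => True
  | .ofTy A => A.Over P V
  | .eqTy A B => A.Over P V ∧ B.Over P V
  | .eqTm s t A => s.Over P V ∧ t.Over P V ∧ A.Over P V

/-- `some C` if the boundary thesis is `□ : C`. -/
def type? {c : Cls} {n : ℕ} : BdryThesis S c n → Option (TyExpr S n)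
  | .ofTy C => some C
  | _ => none

/-- The equation boundary obtained by relating two heads of an object boundary:
`A ≡ B by □` for `□ type`, and `s ≡ t : C by □` for `□ : C`. -/
def eqBdry {o : Kind} {n : ℕ} :
    BdryThesis S (.obj o) n → Expr S (.obj o) n → Expr S (.obj o) n → BdryThesis S (.eqn o) n
  | .isTy, A, B => .eqTy A B
  | .ofTy C, s, t => .eqTm s t C

end BdryThesis

/-- Abstracted boundaries `{x_0 : A_0} ⋯ {x_{k-1} : A_{k-1}} b` of arity `(c, k)`; the type `A_j`
is in the scope of `x_0, ..., x_{j-1}`. -/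
@[ext]
structure Bdry (S : Signature.{u}) (c : Cls) (k : ℕ) where
  types : ∀ j : Fin k, TyExpr S j
  thesis : BdryThesis S c k

/-- Abstracted judgements. A judgement is the same thing as a boundary `B` together with the head
`e` that fills its placeholder, where the head of an equation is `⋆`. -/
@[ext]
structure Jdg (S : Signature.{u}) (c : Cls) (k : ℕ) where
  bdry : Bdry S c k
  head : Expr S c k

/-- A boundary thesis as a boundary with no abstractions. -/
def BdryThesis.toBdry {c : Cls} (b : BdryThesis S c 0) : Bdry S c 0 := ⟨fun j => j.elim0, b⟩

namespace Bdry

/-- The type `A` in `{x : A} B`. -/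
def headType {c : Cls} {k : ℕ} (B : Bdry S c (k + 1)) : TyExpr S 0 := B.types ⟨0, k.succ_pos⟩

/-- The boundary `B[a/x]`, given `{x : A} B`. -/
def openVar {c : Cls} {k : ℕ} (a : ℕ) (B : Bdry S c (k + 1)) : Bdry S c k :=
  ⟨fun j => Expr.openVar a (B.types j.succ), B.thesis.openVar a⟩

def inst (I : Inst S) {c : Cls} {k : ℕ} (B : Bdry S c k) : Bdry S c k :=
  ⟨fun j => (B.types j).inst I, B.thesis.inst I⟩

def Over (P : Cls → ℕ → ℕ → Prop) (V : ℕ → Prop) {c : Cls} {k : ℕ} (B : Bdry S c k) : Prop :=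
  (∀ j, (B.types j).Over P V) ∧ B.thesis.Over P V

/-- The type `A_j[t_0/x_0, ..., t_{j-1}/x_{j-1}]`. -/
def argType {c : Cls} {k : ℕ} (B : Bdry S c k) (t : Fin k → TmExpr S 0) (j : Fin k) : TyExpr S 0 :=
  (B.types j).subst fun i => t (Fin.castLE j.is_lt.le i)

/-- Filling the placeholder with a head. -/
def fill {c : Cls} {k : ℕ} (B : Bdry S c k) (e : Expr S c k) : Jdg S c k := ⟨B, e⟩

/-- Filling the placeholder of an object boundary with an equation. -/
def fillEq {o : Kind} {k : ℕ} (B : Bdry S (.obj o) k) (e₁ e₂ : Expr S (.obj o) k) :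
    Jdg S (.eqn o) k :=
  ⟨⟨B.types, B.thesis.eqBdry e₁ e₂⟩, .dummy o⟩

end Bdry

namespace Jdg

/-- The judgement `A type`. -/
def isTy (A : TyExpr S 0) : Jdg S (.obj .ty) 0 := BdryThesis.isTy.toBdry.fill A

/-- The judgement `t : A`. -/
def ofTy (t : TmExpr S 0) (A : TyExpr S 0) : Jdg S (.obj .tm) 0 := (BdryThesis.ofTy A).toBdry.fill t

/-- The judgement `A ≡ B by ⋆`. -/
def eqTy (A B : TyExpr S 0) : Jdg S (.eqn .ty) 0 := (BdryThesis.eqTy A B).toBdry.fill (.dummy .ty)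

/-- The judgement `s ≡ t : A by ⋆`. -/
def eqTm (s t : TmExpr S 0) (A : TyExpr S 0) : Jdg S (.eqn .tm) 0 :=
  (BdryThesis.eqTm s t A).toBdry.fill (.dummy .tm)

/-- The judgement `J[a/x]`, given `{x : A} J`. -/
def openVar {c : Cls} {k : ℕ} (a : ℕ) (J : Jdg S c (k + 1)) : Jdg S c k :=
  ⟨J.bdry.openVar a, Expr.openVar a J.head⟩

def Over (P : Cls → ℕ → ℕ → Prop) (V : ℕ → Prop) {c : Cls} {k : ℕ} (J : Jdg S c k) : Prop :=
  J.bdry.Over P V ∧ J.head.Over P V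

end Jdg

/-- Judgements and boundaries, which may appear on the right of `⊢`. -/
inductive Form (S : Signature.{u})
  | jdg {c : Cls} {k : ℕ} (J : Jdg S c k)
  | bdry {c : Cls} {k : ℕ} (B : Bdry S c k)

/-! ## Contexts

Contexts are lists with the newest entry first: `x :: L` stands for the extension `L, x`. -/

/-- An entry `M : B` of a metavariable context, with `M` of the arity of `B`. -/
structure MEntry (S : Signature.{u}) where
  cls : Cls
  ar : ℕ
  name : ℕ
  bdry : Bdry S cls ar

/-- Metavariable contexts. -/
abbrev MCtx (S : Signature.{u}) := List (MEntry S)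

/-- Variable contexts. -/
abbrev VCtx (S : Signature.{u}) := List (ℕ × TyExpr S 0)

/-- The metavariable `M` of arity `(c, k)` is in `|Θ|`. -/
def MCtx.Dom (Θ : MCtx S) (c : Cls) (k M : ℕ) : Prop := ∃ B : Bdry S c k, ⟨c, k, M, B⟩ ∈ Θ

/-- The free variable `a` is in `|Γ|`. -/
def VCtx.Dom (Γ : VCtx S) (a : ℕ) : Prop := ∃ A : TyExpr S 0, (a, A) ∈ Γ

/-- Syntactic validity of a metavariable context: metavariables are distinct, and each boundary
is closed and mentions only earlier metavariables. -/
def MCtx.Valid : MCtx S → Prop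
  | [] => True
  | e :: Θ => MCtx.Valid Θ ∧ ¬ MCtx.Dom Θ e.cls e.ar e.name ∧
      e.bdry.Over (MCtx.Dom Θ) (VCtx.Dom (S := S) [])

/-- Syntactic validity of a variable context over a metavariable context: variables are distinct,
and each type mentions only earlier variables. -/
def VCtx.Valid (Θ : MCtx S) : VCtx S → Prop
  | [] => True
  | (a, A) :: Γ => VCtx.Valid Θ Γ ∧ ¬ VCtx.Dom Γ a ∧ A.Over Θ.Dom (VCtx.Dom Γ)

/-- `I` is an instantiation of `Ξ` over `Θ; Γ`: its values at the metavariables of `Ξ` are valid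
over `Θ; Γ`. -/
def Inst.Valid (I : Inst S) (Ξ Θ : MCtx S) (Γ : VCtx S) : Prop :=
  ∀ c k M, Ξ.Dom c k M → (I c k M).Over Θ.Dom Γ.Dom

/-! ## Raw rules, raw type theories, derivability -/

/-- A raw rule `Ξ ⟹ b[e]` whose conclusion is of class `c`: a syntactically valid hypothetical
judgement with empty variable context and non-abstracted conclusion. It is an object rule when
`c = obj o`, and an equality rule when `c = eqn o`. -/
structure RawRule (S : Signature.{u}) (c : Cls) where
  prem : MCtx S
  bdry : BdryThesis S c 0
  head : Expr S c 0
  prem_valid : prem.Valid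
  bdry_valid : bdry.Over prem.Dom (VCtx.Dom (S := S) [])
  head_valid : head.Over prem.Dom (VCtx.Dom (S := S) [])

/-- A raw type theory: a family of raw rules, the specific rules. -/
structure RawTheory (S : Signature.{u}) where
  Idx : Type v
  rule : Idx → Σ c : Cls, RawRule S c

/-- `R` is one of the specific rules of `T`. -/
def RawTheory.HasRule (T : RawTheory.{u, v} S) {c : Cls} (R : RawRule S c) : Prop :=
  ∃ i, T.rule i = ⟨c, R⟩

/-- Derivability `Θ; Γ ⊢_T F` in the deductive system associated with `T`. The contexts and the
conclusion of every rule are understood to be syntactically valid; this is required explicitly in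
those rules where it does not follow from the validity of the premises. The boundary of the `i`-th
premise of a rule contains only the metavariables that precede the `i`-th one, hence `B.inst I` is
the instantiation of it by the restriction of `I` to these. -/
inductive Derives (T : RawTheory.{u, v} S) (Θ : MCtx S) : VCtx S → Form S → Prop
  -- structural rules
  | var {Γ : VCtx S} {a : ℕ} {A : TyExpr S 0} (hΘ : Θ.Valid) (hΓ : Γ.Valid Θ) (h : (a, A) ∈ Γ) :
      Derives T Θ Γ (.jdg (.ofTy (.fvar a) A))
  | mvar {Γ : VCtx S} {c : Cls} {k M : ℕ} {B : Bdry S c k} {t : Fin k → TmExpr S 0}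
      (hM : ⟨c, k, M, B⟩ ∈ Θ)
      (ht : ∀ j, Derives T Θ Γ (.jdg (.ofTy (t j) (B.argType t j))))
      (hB : Derives T Θ Γ (.bdry (B.thesis.subst t).toBdry)) :
      Derives T Θ Γ (.jdg ((B.thesis.subst t).toBdry.fill (mvarApp c M t)))
  | mvarCongr {Γ : VCtx S} {o : Kind} {k M : ℕ} {B : Bdry S (.obj o) k} {s t : Fin k → TmExpr S 0}
      (hΘ : Θ.Valid) (hΓ : Γ.Valid Θ)
      (hM : ⟨.obj o, k, M, B⟩ ∈ Θ)
      (hs : ∀ j, Derives T Θ Γ (.jdg (.ofTy (s j) (B.argType s j))))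
      (ht : ∀ j, Derives T Θ Γ (.jdg (.ofTy (t j) (B.argType t j))))
      (hst : ∀ j, Derives T Θ Γ (.jdg (.eqTm (s j) (t j) (B.argType s j))))
      (hC : ∀ C, B.thesis.type? = some C → Derives T Θ Γ (.jdg (.eqTy (C.subst s) (C.subst t)))) :
      Derives T Θ Γ
        (.jdg ((B.thesis.subst s).toBdry.fillEq (mvarApp (.obj o) M s) (mvarApp (.obj o) M t)))
  | abstr {Γ : VCtx S} {c : Cls} {k a : ℕ} {J : Jdg S c (k + 1)}
      (hJ : J.Over Θ.Dom Γ.Dom)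
      (hA : Derives T Θ Γ (.jdg (.isTy J.bdry.headType)))
      (ha : ¬ Γ.Dom a)
      (h : Derives T Θ ((a, J.bdry.headType) :: Γ) (.jdg (J.openVar a))) :
      Derives T Θ Γ (.jdg J)
  -- equality rules
  | eqTyRefl {Γ : VCtx S} {A : TyExpr S 0} (h : Derives T Θ Γ (.jdg (.isTy A))) :
      Derives T Θ Γ (.jdg (.eqTy A A))
  | eqTySymm {Γ : VCtx S} {A B : TyExpr S 0} (h : Derives T Θ Γ (.jdg (.eqTy A B))) :
      Derives T Θ Γ (.jdg (.eqTy B A))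
  | eqTyTrans {Γ : VCtx S} {A B C : TyExpr S 0} (h₁ : Derives T Θ Γ (.jdg (.eqTy A B)))
      (h₂ : Derives T Θ Γ (.jdg (.eqTy B C))) :
      Derives T Θ Γ (.jdg (.eqTy A C))
  | eqTmRefl {Γ : VCtx S} {t : TmExpr S 0} {A : TyExpr S 0} (h : Derives T Θ Γ (.jdg (.ofTy t A))) :
      Derives T Θ Γ (.jdg (.eqTm t t A))
  | eqTmSymm {Γ : VCtx S} {s t : TmExpr S 0} {A : TyExpr S 0}
      (h : Derives T Θ Γ (.jdg (.eqTm s t A))) :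
      Derives T Θ Γ (.jdg (.eqTm t s A))
  | eqTmTrans {Γ : VCtx S} {s t w : TmExpr S 0} {A : TyExpr S 0}
      (h₁ : Derives T Θ Γ (.jdg (.eqTm s t A))) (h₂ : Derives T Θ Γ (.jdg (.eqTm t w A))) :
      Derives T Θ Γ (.jdg (.eqTm s w A))
  | convTm {Γ : VCtx S} {t : TmExpr S 0} {A B : TyExpr S 0} (h : Derives T Θ Γ (.jdg (.ofTy t A)))
      (hAB : Derives T Θ Γ (.jdg (.eqTy A B))) :
      Derives T Θ Γ (.jdg (.ofTy t B))
  | convEqTm {Γ : VCtx S} {s t : TmExpr S 0} {A B : TyExpr S 0}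
      (h : Derives T Θ Γ (.jdg (.eqTm s t A))) (hAB : Derives T Θ Γ (.jdg (.eqTy A B))) :
      Derives T Θ Γ (.jdg (.eqTm s t B))
  -- boundary rules
  | bdryTy {Γ : VCtx S} (hΘ : Θ.Valid) (hΓ : Γ.Valid Θ) :
      Derives T Θ Γ (.bdry (BdryThesis.isTy (S := S)).toBdry)
  | bdryTm {Γ : VCtx S} {A : TyExpr S 0} (hA : Derives T Θ Γ (.jdg (.isTy A))) :
      Derives T Θ Γ (.bdry (BdryThesis.ofTy A).toBdry)
  | bdryEqTy {Γ : VCtx S} {A B : TyExpr S 0} (hA : Derives T Θ Γ (.jdg (.isTy A)))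
      (hB : Derives T Θ Γ (.jdg (.isTy B))) :
      Derives T Θ Γ (.bdry (BdryThesis.eqTy A B).toBdry)
  | bdryEqTm {Γ : VCtx S} {s t : TmExpr S 0} {A : TyExpr S 0}
      (hA : Derives T Θ Γ (.jdg (.isTy A))) (hs : Derives T Θ Γ (.jdg (.ofTy s A)))
      (ht : Derives T Θ Γ (.jdg (.ofTy t A))) :
      Derives T Θ Γ (.bdry (BdryThesis.eqTm s t A).toBdry)
  | bdryAbstr {Γ : VCtx S} {c : Cls} {k a : ℕ} {B : Bdry S c (k + 1)}
      (hB : B.Over Θ.Dom Γ.Dom)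
      (hA : Derives T Θ Γ (.jdg (.isTy B.headType)))
      (ha : ¬ Γ.Dom a)
      (h : Derives T Θ ((a, B.headType) :: Γ) (.bdry (B.openVar a))) :
      Derives T Θ Γ (.bdry B)
  -- instantiations of specific rules
  | specific {Γ : VCtx S} {c : Cls} {R : RawRule S c} {I : Inst S} (hR : T.HasRule R)
      (hI : ∀ c k M (B : Bdry S c k), ⟨c, k, M, B⟩ ∈ R.prem →
        Derives T Θ Γ (.jdg ((B.inst I).fill (I c k M))))
      (hb : Derives T Θ Γ (.bdry (R.bdry.inst I).toBdry)) :
      Derives T Θ Γ (.jdg ((R.bdry.inst I).toBdry.fill (R.head.inst I)))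
  -- congruence rules associated with the specific object rules
  | congr {Γ : VCtx S} {o : Kind} {R : RawRule S (.obj o)} {I J : Inst S}
      (hΘ : Θ.Valid) (hΓ : Γ.Valid Θ) (hR : T.HasRule R)
      (hI : ∀ c k M (B : Bdry S c k), ⟨c, k, M, B⟩ ∈ R.prem →
        Derives T Θ Γ (.jdg ((B.inst I).fill (I c k M))))
      (hJ : ∀ c k M (B : Bdry S c k), ⟨c, k, M, B⟩ ∈ R.prem →
        Derives T Θ Γ (.jdg ((B.inst J).fill (J c k M))))
      (hIJ : ∀ o' k M (B : Bdry S (.obj o') k), ⟨.obj o', k, M, B⟩ ∈ R.prem →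
        Derives T Θ Γ (.jdg ((B.inst I).fillEq (I (.obj o') k M) (J (.obj o') k M))))
      (hC : ∀ C, R.bdry.type? = some C → Derives T Θ Γ (.jdg (.eqTy (C.inst I) (C.inst J)))) :
      Derives T Θ Γ (.jdg ((R.bdry.inst I).toBdry.fillEq (R.head.inst I) (R.head.inst J)))

/-- `⊢_T Θ mctx`: well-formed metavariable contexts. -/
inductive IsMCtx (T : RawTheory.{u, v} S) : MCtx S → Prop
  | nil : IsMCtx T []
  | cons {Θ : MCtx S} {e : MEntry S} (hΘ : IsMCtx T Θ) (hB : Derives T Θ [] (.bdry e.bdry))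
      (he : ¬ Θ.Dom e.cls e.ar e.name) : IsMCtx T (e :: Θ)

/-- `Θ ⊢_T Γ vctx`: well-formed variable contexts. -/
inductive IsVCtx (T : RawTheory.{u, v} S) (Θ : MCtx S) : VCtx S → Prop
  | nil : IsVCtx T Θ []
  | cons {Γ : VCtx S} {a : ℕ} {A : TyExpr S 0} (hΓ : IsVCtx T Θ Γ)
      (hA : Derives T Θ Γ (.jdg (.isTy A))) (ha : ¬ Γ.Dom a) : IsVCtx T Θ ((a, A) :: Γ)

/-- A raw rule is finitary over `T` when its premises form a well-formed metavariable context over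
which the boundary of its conclusion is derivable. -/
def RawRule.FinitaryOver (T : RawTheory.{u, v} S) {c : Cls} (R : RawRule S c) : Prop :=
  IsMCtx T R.prem ∧ Derives T R.prem [] (.bdry R.bdry.toBdry)

/-- The subfamily of the rules whose index satisfies `p`. -/
def RawTheory.restrict (T : RawTheory.{u, v} S) (p : T.Idx → Prop) : RawTheory.{u, v} S :=
  ⟨{i // p i}, fun i => T.rule i.1⟩

/-- A finitary type theory: a raw type theory whose rules may be well-ordered by a strict
well-founded order so that each rule is finitary over the rules that precede it. -/
def RawTheory.IsFinitary (T : RawTheory.{u, v} S) : Prop :=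
  ∃ r : T.Idx → T.Idx → Prop, IsStrictOrder T.Idx r ∧ WellFounded r ∧
    ∀ i, (T.rule i).2.FinitaryOver (T.restrict fun j => r j i)

end FTT

open FTT

namespace FTT

variable {S : Signature.{u}}

/-! ## The substitution calculus -/

/-! The full congruence rule asks for more than the economic one: each `f_i` typed in the
`I`-instance of its boundary, each `g_i` typed in the `J`-instance, and `I_*B ≡ J_*B` when the rule
forms a term of type `B`. All of this can be recovered from the equations, going through the
premises in order. Suppose that `I` and `J` are derivable and judgementally equal on the
metavariables before `M_i`. Since the rule is finitary, the boundary `B_i` is derivable over these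
metavariables. Presuppositivity (`Derives.fill_of_fillEq`) types both `f_i` and `g_i` in the
`I`-instance of `B_i`. Equal instantiations send derivable types and terms to equal ones
(`Derives.actEq`), so `g_i` can be converted to the `J`-instance (`Derives.conv_bdry`). For an
equation premise both heads are `⋆`, and conversion alone suffices. This is `IsEqInst.of_eq`.
Finally, `b` is derivable over all premises, and `Derives.actEq` applied to it gives `I_*B ≡ J_*B`.

The weight lies in the metatheorems. Instantiation of metavariables and substitution of free
variables are merged into one action `Expr.act`. One induction on derivations, `Derives.act_of`,
reduces its admissibility to variables and metavariables; it is used for renaming, substitution and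
instantiation, in this order. A substitution passes under a binder by weakening, and instantiating
`M(t)` substitutes `t` into a derivable abstracted judgement. In the same way `Derives.actEq_of`
serves for equal substitutions and then for equal instantiations. Instantiating the congruence `M(s)
≡ M(t)` already requires equal substitution, so `Derives.act` comes after `Derives.substEq`. -/

instance Expr.subsingleton_eqn {o : Kind} {n : ℕ} : Subsingleton (Expr S (.eqn o) n) :=
  ⟨fun e e' => by cases e; cases e'; rfl⟩

theorem liftRen_comp {n m l : ℕ} (ρ : Fin n → Fin m) (ρ' : Fin m → Fin l) (b : ℕ) :
    liftRen ρ' b ∘ liftRen ρ b = liftRen (ρ' ∘ ρ) b := by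
  funext i
  refine Fin.addCases (fun i => ?_) (fun i => ?_) i <;> simp [liftRen]

/-- `liftSub` goes under binders by renaming. Hence the composition law for substitutions rests on
the laws for two renamings and for the two mixed cases. -/
theorem Expr.rename_rename {c : Cls} {n m l : ℕ} (e : Expr S c n) (ρ : Fin n → Fin m)
    (ρ' : Fin m → Fin l) : (e.rename ρ).rename ρ' = e.rename (ρ' ∘ ρ) := by
  induction e generalizing m l with
  | bvar => rfl
  | fvar => rfl
  | symb s es ih => simp [rename, ih, liftRen_comp]
  | mvar M ts ih => simp [rename, ih]
  | dummy => rfl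

theorem liftSub_comp_liftRen {n m l : ℕ} (ρ : Fin n → Fin m) (σ : Fin m → TmExpr S l) (b : ℕ) :
    liftSub σ b ∘ liftRen ρ b = liftSub (σ ∘ ρ) b := by
  funext i
  refine Fin.addCases (fun i => ?_) (fun i => ?_) i <;> simp [liftRen, liftSub]

theorem Expr.subst_rename {c : Cls} {n m l : ℕ} (e : Expr S c n) (ρ : Fin n → Fin m)
    (σ : Fin m → TmExpr S l) : (e.rename ρ).subst σ = e.subst (σ ∘ ρ) := by
  induction e generalizing m l with
  | bvar => rfl
  | fvar => rfl
  | symb s es ih => simp [rename, subst, ih, liftSub_comp_liftRen]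
  | mvar M ts ih => simp [rename, subst, ih]
  | dummy => rfl

theorem rename_liftSub {n m l : ℕ} (σ : Fin n → TmExpr S m) (ρ : Fin m → Fin l) (b : ℕ) :
    (fun i => (liftSub σ b i).rename (liftRen ρ b)) = liftSub (fun i => (σ i).rename ρ) b := by
  funext i
  refine Fin.addCases (fun i => ?_) (fun i => ?_) i
  · simp only [liftSub, Fin.addCases_left, Expr.rename_rename]
    congr 1
    funext j
    simp [liftRen]
  · simp [liftSub, Expr.rename, liftRen]

theorem Expr.rename_subst {c : Cls} {n m l : ℕ} (e : Expr S c n) (σ : Fin n → TmExpr S m)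
    (ρ : Fin m → Fin l) : (e.subst σ).rename ρ = e.subst fun i => (σ i).rename ρ := by
  induction e generalizing m l with
  | bvar => rfl
  | fvar => rfl
  | symb s es ih => simp [rename, subst, ih, rename_liftSub]
  | mvar M ts ih => simp [rename, subst, ih]
  | dummy => rfl

theorem subst_liftSub {n m l : ℕ} (σ : Fin n → TmExpr S m) (τ : Fin m → TmExpr S l) (b : ℕ) :
    (fun i => (liftSub σ b i).subst (liftSub τ b)) = liftSub (fun i => (σ i).subst τ) b := by
  funext i
  refine Fin.addCases (fun i => ?_) (fun i => ?_) i
  · simp only [liftSub, Fin.addCases_left, Expr.subst_rename, Expr.rename_subst]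
    congr 1
    funext j
    simp [liftSub]
  · simp [liftSub, Expr.subst]

theorem Expr.subst_subst {c : Cls} {n m l : ℕ} (e : Expr S c n) (σ : Fin n → TmExpr S m)
    (τ : Fin m → TmExpr S l) : (e.subst σ).subst τ = e.subst fun i => (σ i).subst τ := by
  induction e generalizing m l with
  | bvar => rfl
  | fvar => rfl
  | symb s es ih => simp [subst, ih, subst_liftSub]
  | mvar M ts ih => simp [subst, ih]
  | dummy => rfl

theorem liftSub_bvar {n : ℕ} (b : ℕ) : liftSub (S := S) (n := n) Expr.bvar b = Expr.bvar := by
  funext i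
  refine Fin.addCases (fun i => ?_) (fun i => ?_) i <;> simp [liftSub, Expr.rename]

theorem Expr.subst_bvar {c : Cls} {n : ℕ} (e : Expr S c n) : e.subst Expr.bvar = e := by
  induction e with
  | bvar => rfl
  | fvar => rfl
  | symb s es ih => simp [subst, ih, liftSub_bvar]
  | mvar M ts ih => simp [subst, ih]
  | dummy => rfl

theorem Expr.rename_eq_subst {c : Cls} {n m : ℕ} (e : Expr S c n) (ρ : Fin n → Fin m) :
    e.rename ρ = e.subst fun i => .bvar (ρ i) := by
  rw [← (e.rename ρ).subst_bvar, subst_rename]; rfl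

/-- An expression without bound variables, in the scope of `n` bound variables. -/
def Expr.weaken {c : Cls} (n : ℕ) (e : Expr S c 0) : Expr S c n := e.rename Fin.elim0

theorem Expr.weaken_zero {c : Cls} (e : Expr S c 0) : e.weaken 0 = e := by
  rw [weaken, rename_eq_subst]
  refine Eq.trans ?_ e.subst_bvar
  congr 1
  funext i
  exact i.elim0

theorem Expr.rename_weaken {c : Cls} {n m : ℕ} (e : Expr S c 0) (ρ : Fin n → Fin m) :
    (e.weaken n).rename ρ = e.weaken m := by
  rw [weaken, weaken, rename_rename]
  congr 1
  funext i
  exact i.elim0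

theorem Expr.subst_weaken {c : Cls} {n m : ℕ} (e : Expr S c 0) (σ : Fin n → TmExpr S m) :
    (e.weaken n).subst σ = e.weaken m := by
  rw [weaken, weaken, subst_rename, rename_eq_subst]
  congr 1
  funext i
  exact i.elim0

/-- `e[t/x_0]`: replace the outermost bound variable by a term. -/
def Expr.openTm {c : Cls} {n : ℕ} (e : Expr S c (n + 1)) (t : TmExpr S 0) : Expr S c n :=
  e.subst (Fin.cases (t.weaken n) .bvar)

/-- Simultaneous instantiation of metavariables by `I` and substitution of free variables
by `σ`. -/
def Expr.act (I : Inst S) (σ : ℕ → TmExpr S 0) {c : Cls} {n : ℕ} : Expr S c n → Expr S c n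
  | .bvar i => .bvar i
  | .fvar a => (σ a).weaken _
  | .symb s es => .symb s fun i => (es i).act I σ
  | .mvar (o := o) (k := k) M ts => (I (.obj o) k M).subst fun j => (ts j).act I σ
  | .dummy o => .dummy o

theorem Expr.act_rename (I : Inst S) (σ : ℕ → TmExpr S 0) {c : Cls} {n m : ℕ} (e : Expr S c n)
    (ρ : Fin n → Fin m) : (e.rename ρ).act I σ = (e.act I σ).rename ρ := by
  induction e generalizing m with
  | bvar => rfl
  | fvar => simp [rename, act, rename_weaken]
  | symb s es ih => simp [rename, act, ih]
  | mvar M ts ih => simp [rename, act, ih, rename_subst]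
  | dummy => rfl

theorem Expr.act_liftSub (I : Inst S) (σ : ℕ → TmExpr S 0) {n m : ℕ} (β : Fin n → TmExpr S m)
    (b : ℕ) : (fun i => (liftSub β b i).act I σ) = liftSub (fun i => (β i).act I σ) b := by
  funext i
  refine Fin.addCases (fun i => ?_) (fun i => ?_) i <;> simp [liftSub, act_rename, act]

/-- The two operations commute because the values of `σ` contain no bound variables, so `β` leaves
them alone; at a metavariable the claim is associativity of substitution. -/
theorem Expr.act_subst (I : Inst S) (σ : ℕ → TmExpr S 0) {c : Cls} {n m : ℕ} (e : Expr S c n)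
    (β : Fin n → TmExpr S m) :
    (e.subst β).act I σ = (e.act I σ).subst fun i => (β i).act I σ := by
  induction e generalizing m with
  | bvar => rfl
  | fvar => simp [subst, act, subst_weaken]
  | symb s es ih => simp [subst, act, ih, act_liftSub]
  | mvar M ts ih => simp [subst, act, ih, subst_subst]
  | dummy => rfl

theorem Expr.act_openTm (I : Inst S) (σ : ℕ → TmExpr S 0) {c : Cls} {n : ℕ}
    (e : Expr S c (n + 1)) (t : TmExpr S 0) :
    (e.openTm t).act I σ = (e.act I σ).openTm (t.act I σ) := by
  rw [openTm, act_subst, openTm]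
  congr 1
  funext i
  refine Fin.cases ?_ (fun i => ?_) i
  · simp [weaken, act_rename]
  · simp [act]

/-- Simultaneous substitution can be done one argument at a time, outermost first. This drives the
inductions on the number of abstractions. -/
theorem Expr.subst_openTm {c : Cls} {n : ℕ} (e : Expr S c (n + 1)) (t : Fin (n + 1) → TmExpr S 0) :
    (e.openTm (t 0)).subst (fun i => t i.succ) = e.subst t := by
  rw [openTm, subst_subst]
  congr 1
  funext i
  refine Fin.cases ?_ (fun i => ?_) i
  · simp [subst_weaken, weaken_zero]
  · simp [subst]

theorem Expr.act_congr {P : Cls → ℕ → ℕ → Prop} {V : ℕ → Prop} {I J : Inst S}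
    {σ τ : ℕ → TmExpr S 0} {c : Cls} {n : ℕ} {e : Expr S c n} (he : e.Over P V)
    (hIJ : ∀ c k M, P c k M → I c k M = J c k M) (hστ : ∀ a, V a → σ a = τ a) :
    e.act I σ = e.act J τ := by
  induction e with
  | bvar => rfl
  | fvar a => simp [act, hστ a he]
  | symb s es ih => simp only [act]; congr 1; funext i; exact ih i (he i)
  | mvar M ts ih =>
    simp only [act]; rw [hIJ _ _ _ he.1]; congr 1; funext i; exact ih i (he.2 i)
  | dummy => rfl

theorem Expr.act_fvar (I : Inst S) {c : Cls} {n : ℕ} (e : Expr S c n) :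
    e.act I .fvar = e.inst I := by
  induction e with
  | bvar => rfl
  | fvar a => rfl
  | symb s es ih => simp [act, inst, ih]
  | mvar M ts ih => simp [act, inst, ih]
  | dummy => rfl

theorem Expr.act_eq_inst {P : Cls → ℕ → ℕ → Prop} (I : Inst S) (σ : ℕ → TmExpr S 0) {c : Cls}
    {n : ℕ} {e : Expr S c n} (he : e.Over P (VCtx.Dom (S := S) [])) : e.act I σ = e.inst I := by
  rw [← act_fvar]
  exact act_congr he (fun _ _ _ _ => rfl) (fun a ha => by obtain ⟨A, h⟩ := ha; cases h)

/-- The action on instantiations. -/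
def Inst.act (K : Inst S) (I : Inst S) (σ : ℕ → TmExpr S 0) : Inst S :=
  fun c k M => (K c k M).act I σ

/-- Closedness is essential: `inst` leaves a free variable of `e` in place, whereas `σ` would move
it. Raw rules are closed, so the action sends an instance of a rule to an instance of the same rule.
-/
theorem Expr.act_inst {P : Cls → ℕ → ℕ → Prop} (I : Inst S) (σ : ℕ → TmExpr S 0) (K : Inst S)
    {c : Cls} {n : ℕ} {e : Expr S c n} (he : e.Over P (VCtx.Dom (S := S) [])) :
    (e.inst K).act I σ = e.inst (K.act I σ) := by
  induction e with
  | bvar => rfl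
  | fvar a => obtain ⟨A, h⟩ := he; cases h
  | symb s es ih => simp only [inst, act]; congr 1; funext i; exact ih i (he i)
  | mvar M ts ih =>
    simp only [inst, act_subst]
    exact congrArg (fun ts => Expr.subst ts ((K _ _ M).act I σ)) (funext fun i => ih i (he.2 i))
  | dummy => rfl

/-- The identity instantiation `M ↦ {x_1} ⋯ {x_k} M(x_1, ..., x_k)`. -/
def idInst : Inst S := fun c _ M => mvarApp c M .bvar

theorem Expr.inst_id {c : Cls} {n : ℕ} (e : Expr S c n) : e.inst idInst = e := by
  induction e with
  | bvar => rfl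
  | fvar a => rfl
  | symb s es ih => simp [inst, ih]
  | mvar M ts ih => simp [inst, ih, idInst, mvarApp, subst]
  | dummy => rfl

/-! ## Expressions over given metavariables and variables -/

theorem Expr.Over.mono {P P' : Cls → ℕ → ℕ → Prop} {V V' : ℕ → Prop} {c : Cls} {n : ℕ}
    {e : Expr S c n} (he : e.Over P V) (hP : ∀ c k M, P c k M → P' c k M) (hV : ∀ a, V a → V' a) :
    e.Over P' V' := by
  induction e with
  | bvar => trivial
  | fvar a => exact hV a he
  | symb s es ih => exact fun i => ih i (he i)
  | mvar M ts ih => exact ⟨hP _ _ _ he.1, fun i => ih i (he.2 i)⟩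
  | dummy => trivial

theorem Expr.Over.rename {P : Cls → ℕ → ℕ → Prop} {V : ℕ → Prop} {c : Cls} {n m : ℕ}
    {e : Expr S c n} (he : e.Over P V) (ρ : Fin n → Fin m) : (e.rename ρ).Over P V := by
  induction e generalizing m with
  | bvar => trivial
  | fvar a => exact he
  | symb s es ih => exact fun i => ih i (he i) _
  | mvar M ts ih => exact ⟨he.1, fun i => ih i (he.2 i) _⟩
  | dummy => trivial

theorem Expr.Over.subst {P : Cls → ℕ → ℕ → Prop} {V : ℕ → Prop} {c : Cls} {n m : ℕ}
    {e : Expr S c n} (he : e.Over P V) {β : Fin n → TmExpr S m} (hβ : ∀ i, (β i).Over P V) :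
    (e.subst β).Over P V := by
  induction e generalizing m with
  | bvar i => exact hβ i
  | fvar a => exact he
  | symb s es ih =>
    refine fun i => ih i (he i) fun j => ?_
    refine Fin.addCases (fun j => ?_) (fun j => ?_) j
    · simpa [liftSub] using (hβ j).rename _
    · simp [liftSub, Over]
  | mvar M ts ih => exact ⟨he.1, fun i => ih i (he.2 i) hβ⟩
  | dummy => trivial

theorem Expr.Over.act {P P' : Cls → ℕ → ℕ → Prop} {V V' : ℕ → Prop} {I : Inst S}
    {σ : ℕ → TmExpr S 0} {c : Cls} {n : ℕ} {e : Expr S c n} (he : e.Over P V)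
    (hI : ∀ c k M, P c k M → (I c k M).Over P' V') (hσ : ∀ a, V a → (σ a).Over P' V') :
    (e.act I σ).Over P' V' := by
  induction e with
  | bvar => trivial
  | fvar a => exact (hσ a he).rename _
  | symb s es ih => exact fun i => ih i (he i)
  | mvar M ts ih => exact (hI _ _ _ he.1).subst fun i => ih i (he.2 i)
  | dummy => trivial

/-! ## Boundaries and judgements under instantiation and substitution -/

namespace BdryThesis

def act (I : Inst S) (σ : ℕ → TmExpr S 0) {c : Cls} {n : ℕ} : BdryThesis S c n → BdryThesis S c n
  | .isTy => .isTy
  | .ofTy A => .ofTy (A.act I σ)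
  | .eqTy A B => .eqTy (A.act I σ) (B.act I σ)
  | .eqTm s t A => .eqTm (s.act I σ) (t.act I σ) (A.act I σ)

def openTm {c : Cls} {n : ℕ} (b : BdryThesis S c (n + 1)) (t : TmExpr S 0) : BdryThesis S c n :=
  b.subst (Fin.cases (t.weaken n) .bvar)

theorem act_subst (I : Inst S) (σ : ℕ → TmExpr S 0) {c : Cls} {n m : ℕ} (b : BdryThesis S c n)
    (β : Fin n → TmExpr S m) :
    (b.subst β).act I σ = (b.act I σ).subst fun i => (β i).act I σ := by
  cases b <;> simp [subst, act, Expr.act_subst]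

theorem act_openTm (I : Inst S) (σ : ℕ → TmExpr S 0) {c : Cls} {n : ℕ}
    (b : BdryThesis S c (n + 1)) (t : TmExpr S 0) :
    (b.openTm t).act I σ = (b.act I σ).openTm (t.act I σ) := by
  have h {c' : Cls} (e : Expr S c' (n + 1)) := e.act_openTm I σ t
  simp only [Expr.openTm] at h
  cases b <;> simp [openTm, subst, act, h]

theorem subst_openTm {c : Cls} {n : ℕ} (b : BdryThesis S c (n + 1)) (t : Fin (n + 1) → TmExpr S 0) :
    (b.openTm (t 0)).subst (fun i => t i.succ) = b.subst t := by
  have h {c' : Cls} (e : Expr S c' (n + 1)) := e.subst_openTm t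
  simp only [Expr.openTm] at h
  cases b <;> simp [openTm, subst, h]

theorem subst_bvar {c : Cls} {n : ℕ} (b : BdryThesis S c n) : b.subst .bvar = b := by
  cases b <;> simp [subst, Expr.subst_bvar]

theorem act_congr {P : Cls → ℕ → ℕ → Prop} {V : ℕ → Prop} {I J : Inst S}
    {σ τ : ℕ → TmExpr S 0} {c : Cls} {n : ℕ} {b : BdryThesis S c n} (hb : b.Over P V)
    (hIJ : ∀ c k M, P c k M → I c k M = J c k M) (hστ : ∀ a, V a → σ a = τ a) :
    b.act I σ = b.act J τ := by
  have h {c' : Cls} {e : Expr S c' n} (he : e.Over P V) := Expr.act_congr he hIJ hστ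
  cases b with
  | isTy => rfl
  | ofTy A => simp only [act, h hb]
  | eqTy A B => simp only [act, h hb.1, h hb.2]
  | eqTm s t A => simp only [act, h hb.1, h hb.2.1, h hb.2.2]

theorem act_fvar (I : Inst S) {c : Cls} {n : ℕ} (b : BdryThesis S c n) :
    b.act I .fvar = b.inst I := by
  cases b <;> simp [act, inst, Expr.act_fvar]

theorem act_inst {P : Cls → ℕ → ℕ → Prop} (I : Inst S) (σ : ℕ → TmExpr S 0) (K : Inst S)
    {c : Cls} {n : ℕ} {b : BdryThesis S c n} (hb : b.Over P (VCtx.Dom (S := S) [])) :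
    (b.inst K).act I σ = b.inst (K.act I σ) := by
  have h {c' : Cls} {e : Expr S c' n} (he : e.Over P _) := Expr.act_inst I σ K he
  cases b with
  | isTy => rfl
  | ofTy A => simp only [act, inst, h hb]
  | eqTy A B => simp only [act, inst, h hb.1, h hb.2]
  | eqTm s t A => simp only [act, inst, h hb.1, h hb.2.1, h hb.2.2]

theorem inst_id {c : Cls} {n : ℕ} (b : BdryThesis S c n) : b.inst idInst = b := by
  cases b <;> simp [inst, Expr.inst_id]

theorem Over.mono {P P' : Cls → ℕ → ℕ → Prop} {V V' : ℕ → Prop} {c : Cls} {n : ℕ}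
    {b : BdryThesis S c n} (hb : b.Over P V) (hP : ∀ c k M, P c k M → P' c k M)
    (hV : ∀ a, V a → V' a) : b.Over P' V' := by
  cases b with
  | isTy => trivial
  | ofTy A => exact Expr.Over.mono hb hP hV
  | eqTy A B => exact ⟨Expr.Over.mono hb.1 hP hV, Expr.Over.mono hb.2 hP hV⟩
  | eqTm s t A => exact ⟨Expr.Over.mono hb.1 hP hV, Expr.Over.mono hb.2.1 hP hV,
      Expr.Over.mono hb.2.2 hP hV⟩

theorem Over.act {P P' : Cls → ℕ → ℕ → Prop} {V V' : ℕ → Prop} {I : Inst S}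
    {σ : ℕ → TmExpr S 0} {c : Cls} {n : ℕ} {b : BdryThesis S c n} (hb : b.Over P V)
    (hI : ∀ c k M, P c k M → (I c k M).Over P' V') (hσ : ∀ a, V a → (σ a).Over P' V') :
    (b.act I σ).Over P' V' := by
  cases b with
  | isTy => trivial
  | ofTy A => exact Expr.Over.act hb hI hσ
  | eqTy A B => exact ⟨Expr.Over.act hb.1 hI hσ, Expr.Over.act hb.2 hI hσ⟩
  | eqTm s t A => exact ⟨Expr.Over.act hb.1 hI hσ, Expr.Over.act hb.2.1 hI hσ,
      Expr.Over.act hb.2.2 hI hσ⟩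

theorem act_eqBdry (I : Inst S) (σ : ℕ → TmExpr S 0) {o : Kind} {n : ℕ}
    (b : BdryThesis S (.obj o) n) (s t : Expr S (.obj o) n) :
    (b.eqBdry s t).act I σ = (b.act I σ).eqBdry (s.act I σ) (t.act I σ) := by
  cases b <;> rfl

theorem eqBdry_openTm {o : Kind} {n : ℕ} (b : BdryThesis S (.obj o) (n + 1))
    (s t : Expr S (.obj o) (n + 1)) (u : TmExpr S 0) :
    (b.eqBdry s t).openTm u = (b.openTm u).eqBdry (s.openTm u) (t.openTm u) := by
  cases b <;> rfl

end BdryThesis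

namespace Bdry

def act (I : Inst S) (σ : ℕ → TmExpr S 0) {c : Cls} {k : ℕ} (B : Bdry S c k) : Bdry S c k :=
  ⟨fun j => (B.types j).act I σ, B.thesis.act I σ⟩

/-- The boundary `B[t/x]`, given `{x : A} B`. -/
def openTm {c : Cls} {k : ℕ} (B : Bdry S c (k + 1)) (t : TmExpr S 0) : Bdry S c k :=
  ⟨fun j => Expr.openTm (B.types j.succ) t, B.thesis.openTm t⟩

theorem eq_toBdry {c : Cls} (B : Bdry S c 0) : B = B.thesis.toBdry :=
  Bdry.ext (funext fun j => j.elim0) rfl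

theorem act_openTm (I : Inst S) (σ : ℕ → TmExpr S 0) {c : Cls} {k : ℕ}
    (B : Bdry S c (k + 1)) (t : TmExpr S 0) :
    (B.openTm t).act I σ = (B.act I σ).openTm (t.act I σ) :=
  Bdry.ext (funext fun j => Expr.act_openTm I σ (B.types j.succ) t)
    (BdryThesis.act_openTm I σ B.thesis t)

theorem act_congr {P : Cls → ℕ → ℕ → Prop} {V : ℕ → Prop} {I J : Inst S}
    {σ τ : ℕ → TmExpr S 0} {c : Cls} {k : ℕ} {B : Bdry S c k} (hB : B.Over P V)
    (hIJ : ∀ c k M, P c k M → I c k M = J c k M) (hστ : ∀ a, V a → σ a = τ a) :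
    B.act I σ = B.act J τ :=
  Bdry.ext (funext fun j => Expr.act_congr (hB.1 j) hIJ hστ) (BdryThesis.act_congr hB.2 hIJ hστ)

theorem act_fvar (I : Inst S) {c : Cls} {k : ℕ} (B : Bdry S c k) : B.act I .fvar = B.inst I :=
  Bdry.ext (funext fun j => Expr.act_fvar I (B.types j)) (B.thesis.act_fvar I)

theorem act_eq_inst {P : Cls → ℕ → ℕ → Prop} (I : Inst S) (σ : ℕ → TmExpr S 0) {c : Cls}
    {k : ℕ} {B : Bdry S c k} (hB : B.Over P (VCtx.Dom (S := S) [])) : B.act I σ = B.inst I := by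
  rw [← act_fvar]
  exact act_congr hB (fun _ _ _ _ => rfl) (fun a ha => by obtain ⟨A, h⟩ := ha; cases h)

theorem act_inst {P : Cls → ℕ → ℕ → Prop} (I : Inst S) (σ : ℕ → TmExpr S 0) (K : Inst S)
    {c : Cls} {k : ℕ} {B : Bdry S c k} (hB : B.Over P (VCtx.Dom (S := S) [])) :
    (B.inst K).act I σ = B.inst (K.act I σ) :=
  Bdry.ext (funext fun j => Expr.act_inst I σ K (hB.1 j)) (BdryThesis.act_inst I σ K hB.2)

theorem inst_id {c : Cls} {k : ℕ} (B : Bdry S c k) : B.inst idInst = B :=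
  Bdry.ext (funext fun j => Expr.inst_id (B.types j)) B.thesis.inst_id

theorem act_id {c : Cls} {k : ℕ} (B : Bdry S c k) : B.act idInst .fvar = B := by
  rw [act_fvar, inst_id]

theorem act_argType (I : Inst S) (σ : ℕ → TmExpr S 0) {c : Cls} {k : ℕ} (B : Bdry S c k)
    (t : Fin k → TmExpr S 0) (j : Fin k) :
    (B.argType t j).act I σ = (B.act I σ).argType (fun i => (t i).act I σ) j :=
  Expr.act_subst I σ (B.types j) _

theorem argType_openTm {c : Cls} {k : ℕ} (B : Bdry S c (k + 1)) (t : Fin (k + 1) → TmExpr S 0)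
    (j : Fin k) :
    (B.openTm (t 0)).argType (fun i => t i.succ) j = B.argType t j.succ :=
  Expr.subst_openTm (n := j) (B.types j.succ) fun i => t (Fin.castLE j.succ.is_lt.le i)

theorem argType_zero {c : Cls} {k : ℕ} (B : Bdry S c (k + 1)) (t : Fin (k + 1) → TmExpr S 0) :
    B.argType t 0 = B.headType := by
  refine Eq.trans ?_ (Expr.subst_bvar (n := 0) B.headType)
  exact congrArg (fun β => Expr.subst (n := 0) β B.headType) (funext fun i => i.elim0)

theorem act_fillEq (I : Inst S) (σ : ℕ → TmExpr S 0) {o : Kind} {k : ℕ} (B : Bdry S (.obj o) k)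
    (s t : Expr S (.obj o) k) :
    (B.fillEq s t).bdry.act I σ = ((B.act I σ).fillEq (s.act I σ) (t.act I σ)).bdry :=
  Bdry.ext rfl (B.thesis.act_eqBdry I σ s t)

end Bdry

@[simp]
theorem BdryThesis.toBdry_act (I : Inst S) (σ : ℕ → TmExpr S 0) {c : Cls} (b : BdryThesis S c 0) :
    b.toBdry.act I σ = (b.act I σ).toBdry := Bdry.eq_toBdry _

namespace Jdg

def act (I : Inst S) (σ : ℕ → TmExpr S 0) {c : Cls} {k : ℕ} (J : Jdg S c k) : Jdg S c k :=
  ⟨J.bdry.act I σ, J.head.act I σ⟩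

/-- The judgement `J[t/x]`, given `{x : A} J`. -/
def openTm {c : Cls} {k : ℕ} (J : Jdg S c (k + 1)) (t : TmExpr S 0) : Jdg S c k :=
  ⟨J.bdry.openTm t, J.head.openTm t⟩

theorem act_openTm (I : Inst S) (σ : ℕ → TmExpr S 0) {c : Cls} {k : ℕ}
    (J : Jdg S c (k + 1)) (t : TmExpr S 0) :
    (J.openTm t).act I σ = (J.act I σ).openTm (t.act I σ) :=
  Jdg.ext (J.bdry.act_openTm I σ t) (J.head.act_openTm I σ t)

theorem act_congr {P : Cls → ℕ → ℕ → Prop} {V : ℕ → Prop} {I I' : Inst S}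
    {σ τ : ℕ → TmExpr S 0} {c : Cls} {k : ℕ} {J : Jdg S c k} (hJ : J.Over P V)
    (hI : ∀ c k M, P c k M → I c k M = I' c k M) (hστ : ∀ a, V a → σ a = τ a) :
    J.act I σ = J.act I' τ :=
  Jdg.ext (Bdry.act_congr hJ.1 hI hστ) (Expr.act_congr hJ.2 hI hστ)

theorem act_id {c : Cls} {k : ℕ} (J : Jdg S c k) : J.act idInst .fvar = J :=
  Jdg.ext J.bdry.act_id (by simp [act, Expr.act_fvar, Expr.inst_id])

@[simp]
theorem act_isTy (I : Inst S) (σ : ℕ → TmExpr S 0) (A : TyExpr S 0) :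
    (isTy A).act I σ = isTy (A.act I σ) := by
  simp [isTy, act, Bdry.fill, BdryThesis.act]

@[simp]
theorem act_ofTy (I : Inst S) (σ : ℕ → TmExpr S 0) (t : TmExpr S 0) (A : TyExpr S 0) :
    (ofTy t A).act I σ = ofTy (t.act I σ) (A.act I σ) := by
  simp [ofTy, act, Bdry.fill, BdryThesis.act]

@[simp]
theorem act_eqTy (I : Inst S) (σ : ℕ → TmExpr S 0) (A B : TyExpr S 0) :
    (eqTy A B).act I σ = eqTy (A.act I σ) (B.act I σ) := by
  simp [eqTy, act, Bdry.fill, BdryThesis.act, Expr.act]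

@[simp]
theorem act_eqTm (I : Inst S) (σ : ℕ → TmExpr S 0) (s t : TmExpr S 0) (A : TyExpr S 0) :
    (eqTm s t A).act I σ = eqTm (s.act I σ) (t.act I σ) (A.act I σ) := by
  simp [eqTm, act, Bdry.fill, BdryThesis.act, Expr.act]

theorem act_fillEq (I : Inst S) (σ : ℕ → TmExpr S 0) {o : Kind} {k : ℕ} (B : Bdry S (.obj o) k)
    (s t : Expr S (.obj o) k) :
    (B.fillEq s t).act I σ = (B.act I σ).fillEq (s.act I σ) (t.act I σ) :=
  Jdg.ext (B.act_fillEq I σ s t) rfl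

end Jdg

namespace Bdry

theorem fillEq_openTm {o : Kind} {k : ℕ} (B : Bdry S (.obj o) (k + 1))
    (s t : Expr S (.obj o) (k + 1)) (w : TmExpr S 0) :
    (B.fillEq s t).openTm w = (B.openTm w).fillEq (s.openTm w) (t.openTm w) :=
  Jdg.ext (Bdry.ext rfl (B.thesis.eqBdry_openTm s t w)) rfl

theorem Over.mono {P P' : Cls → ℕ → ℕ → Prop} {V V' : ℕ → Prop} {c : Cls} {k : ℕ}
    {B : Bdry S c k} (hB : B.Over P V) (hP : ∀ c k M, P c k M → P' c k M)
    (hV : ∀ a, V a → V' a) : B.Over P' V' :=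
  ⟨fun j => (hB.1 j).mono hP hV, hB.2.mono hP hV⟩

theorem Over.act {P P' : Cls → ℕ → ℕ → Prop} {V V' : ℕ → Prop} {I : Inst S}
    {σ : ℕ → TmExpr S 0} {c : Cls} {k : ℕ} {B : Bdry S c k} (hB : B.Over P V)
    (hI : ∀ c k M, P c k M → (I c k M).Over P' V') (hσ : ∀ a, V a → (σ a).Over P' V') :
    (B.act I σ).Over P' V' :=
  ⟨fun j => (hB.1 j).act hI hσ, hB.2.act hI hσ⟩

end Bdry

theorem Jdg.Over.act {P P' : Cls → ℕ → ℕ → Prop} {V V' : ℕ → Prop} {I : Inst S}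
    {σ : ℕ → TmExpr S 0} {c : Cls} {k : ℕ} {J : Jdg S c k} (hJ : J.Over P V)
    (hI : ∀ c k M, P c k M → (I c k M).Over P' V') (hσ : ∀ a, V a → (σ a).Over P' V') :
    (J.act I σ).Over P' V' :=
  ⟨hJ.1.act hI hσ, hJ.2.act hI hσ⟩

namespace Form

def act (I : Inst S) (σ : ℕ → TmExpr S 0) : Form S → Form S
  | .jdg J => .jdg (J.act I σ)
  | .bdry B => .bdry (B.act I σ)

def Over (P : Cls → ℕ → ℕ → Prop) (V : ℕ → Prop) : Form S → Prop
  | .jdg J => J.Over P V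
  | .bdry B => B.Over P V

theorem act_id (F : Form S) : F.act idInst .fvar = F := by
  cases F <;> simp [act, Jdg.act_id, Bdry.act_id]

end Form

/-! ## Validity of contexts -/

theorem VCtx.Dom.cons {Γ : VCtx S} {a : ℕ} (h : Γ.Dom a) (p : ℕ × TyExpr S 0) :
    VCtx.Dom (p :: Γ) a := h.imp fun _ => List.mem_cons_of_mem _

theorem VCtx.exists_fresh (Γ : VCtx S) : ∃ a, ¬ Γ.Dom a := by
  obtain ⟨a, ha⟩ := Infinite.exists_notMem_finset (Γ.map Prod.fst).toFinset
  refine ⟨a, fun ⟨A, h⟩ => ha ?_⟩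
  simp only [List.mem_toFinset, List.mem_map]
  exact ⟨_, h, rfl⟩

theorem VCtx.not_dom_nil {a : ℕ} : ¬ VCtx.Dom (S := S) [] a := fun ⟨_, h⟩ => by cases h

theorem VCtx.Valid.over {Θ : MCtx S} {Γ : VCtx S} (hΓ : Γ.Valid Θ) {a : ℕ} {A : TyExpr S 0}
    (h : (a, A) ∈ Γ) : A.Over Θ.Dom Γ.Dom := by
  induction Γ with
  | nil => cases h
  | cons p Γ ih =>
    rcases List.mem_cons.1 h with rfl | h
    · exact hΓ.2.2.mono (fun _ _ _ h => h) fun _ h => h.cons _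
    · exact (ih hΓ.1 h).mono (fun _ _ _ h => h) fun _ h => h.cons _

theorem MCtx.Valid.over {Θ : MCtx S} (hΘ : Θ.Valid) {c : Cls} {k M : ℕ} {B : Bdry S c k}
    (h : ⟨c, k, M, B⟩ ∈ Θ) : B.Over Θ.Dom (VCtx.Dom (S := S) []) := by
  have step (e : MEntry S) (Θ : MCtx S) (c k M) (h : MCtx.Dom Θ c k M) : MCtx.Dom (e :: Θ) c k M :=
    h.imp fun _ => List.mem_cons_of_mem _
  induction Θ with
  | nil => cases h
  | cons e Θ ih =>
    rcases List.mem_cons.1 h with rfl | h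
    · exact hΘ.2.2.mono (step _ _) fun _ h => h
    · exact (ih hΘ.1 h).mono (step _ _) fun _ h => h

/-- Everything that takes part in a derivation is syntactically valid. -/
theorem Derives.valid {T : RawTheory.{u, v} S} {Θ : MCtx S} {Γ : VCtx S} {F : Form S}
    (h : Derives T Θ Γ F) : Θ.Valid ∧ Γ.Valid Θ ∧ F.Over Θ.Dom Γ.Dom := by
  have z {c : Cls} {b : BdryThesis S c 0} {P V} (hb : b.Over P V) : b.toBdry.Over P V :=
    ⟨fun j => j.elim0, hb⟩
  have instOver {c : Cls} {R : RawRule S c} {Γ : VCtx S} {K : Inst S}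
      (hK : ∀ c k M (B : Bdry S c k), ⟨c, k, M, B⟩ ∈ R.prem → (K c k M).Over Θ.Dom Γ.Dom) :
      (R.head.inst K).Over Θ.Dom Γ.Dom := by
    rw [← Expr.act_fvar]
    exact R.head_valid.act (fun c k M ⟨B, hM⟩ => hK c k M B hM)
      fun a ha => (VCtx.not_dom_nil ha).elim
  have eqOver {o : Kind} {b : BdryThesis S (.obj o) 0} {s t : Expr S (.obj o) 0} {P V}
      (hb : b.Over P V) (hs : s.Over P V) (ht : t.Over P V) : (b.eqBdry s t).Over P V := by
    cases b with
    | isTy => exact ⟨hs, ht⟩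
    | ofTy C => exact ⟨hs, ht, hb⟩
  induction h with
  | var hΘ hΓ h => exact ⟨hΘ, hΓ, z (hΓ.over h), ⟨_, h⟩⟩
  | @mvar Γ c k M B t hM ht hB iht ihB =>
    refine ⟨ihB.1, ihB.2.1, ihB.2.2, ?_⟩
    cases c with
    | obj o => exact ⟨⟨B, hM⟩, fun j => (iht j).2.2.2⟩
    | eqn o => trivial
  | @mvarCongr Γ o k M B s t hΘ hΓ hM hs ht hst hC ihs iht ihst ihC =>
    have hB := hΘ.over hM
    refine ⟨hΘ, hΓ, z (eqOver ?_ ⟨⟨B, hM⟩, fun j => (ihs j).2.2.2⟩ ⟨⟨B, hM⟩, fun j => (iht j).2.2.2⟩),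
      trivial⟩
    -- For `□ : C`, the validity of `C[s]` is read off the premise `C[s] ≡ C[t]`.
    generalize B.thesis = b at *
    cases b with
    | isTy => trivial
    | ofTy C => exact (ihC C rfl).2.2.1.2.1
  | abstr hJ _ _ _ ihA _ => exact ⟨ihA.1, ihA.2.1, hJ⟩
  | eqTyRefl _ ih => exact ⟨ih.1, ih.2.1, z ⟨ih.2.2.2, ih.2.2.2⟩, trivial⟩
  | eqTySymm _ ih => exact ⟨ih.1, ih.2.1, z ⟨ih.2.2.1.2.2, ih.2.2.1.2.1⟩, trivial⟩
  | eqTyTrans _ _ ih ih' => exact ⟨ih.1, ih.2.1, z ⟨ih.2.2.1.2.1, ih'.2.2.1.2.2⟩, trivial⟩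
  | eqTmRefl _ ih => exact ⟨ih.1, ih.2.1, z ⟨ih.2.2.2, ih.2.2.2, ih.2.2.1.2⟩, trivial⟩
  | eqTmSymm _ ih =>
    exact ⟨ih.1, ih.2.1, z ⟨ih.2.2.1.2.2.1, ih.2.2.1.2.1, ih.2.2.1.2.2.2⟩, trivial⟩
  | eqTmTrans _ _ ih ih' =>
    exact ⟨ih.1, ih.2.1, z ⟨ih.2.2.1.2.1, ih'.2.2.1.2.2.1, ih.2.2.1.2.2.2⟩, trivial⟩
  | convTm _ _ ih ih' => exact ⟨ih.1, ih.2.1, z ih'.2.2.1.2.2, ih.2.2.2⟩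
  | convEqTm _ _ ih ih' =>
    exact ⟨ih.1, ih.2.1, z ⟨ih.2.2.1.2.1, ih.2.2.1.2.2.1, ih'.2.2.1.2.2⟩, trivial⟩
  | bdryTy hΘ hΓ => exact ⟨hΘ, hΓ, z trivial⟩
  | bdryTm _ ih => exact ⟨ih.1, ih.2.1, z ih.2.2.2⟩
  | bdryEqTy _ _ ih ih' => exact ⟨ih.1, ih.2.1, z ⟨ih.2.2.2, ih'.2.2.2⟩⟩
  | bdryEqTm _ _ _ ih ih' ih'' => exact ⟨ih.1, ih.2.1, z ⟨ih'.2.2.2, ih''.2.2.2, ih.2.2.2⟩⟩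
  | bdryAbstr hB _ _ _ ihA _ => exact ⟨ihA.1, ihA.2.1, hB⟩
  | specific hR hI hb ihI ihb =>
    exact ⟨ihb.1, ihb.2.1, ihb.2.2, instOver fun c k M B hM => (ihI c k M B hM).2.2.2⟩
  | @congr Γ o R I J hΘ hΓ hR hI hJ hIJ hC ihI ihJ ihIJ ihC =>
    refine ⟨hΘ, hΓ, z (eqOver ?_ (instOver fun c k M B hM => (ihI c k M B hM).2.2.2)
      (instOver fun c k M B hM => (ihJ c k M B hM).2.2.2)), trivial⟩
    generalize R.bdry = b at *
    cases b with
    | isTy => trivial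
    | ofTy C => exact (ihC C rfl).2.2.1.2.1

/-! ## Derivations under instantiation and substitution -/

theorem act_mvarApp (I : Inst S) (σ : ℕ → TmExpr S 0) (c : Cls) {k n : ℕ} (M : ℕ)
    (t : Fin k → TmExpr S n) :
    (mvarApp c M t).act I σ = (I c k M).subst fun j => (t j).act I σ := by
  cases c with
  | obj o => rfl
  | eqn o => exact Subsingleton.elim _ _

theorem BdryThesis.type?_act (I : Inst S) (σ : ℕ → TmExpr S 0) {c : Cls} {n : ℕ}
    (b : BdryThesis S c n) : (b.act I σ).type? = b.type?.map (Expr.act I σ) := by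
  cases b <;> rfl

theorem BdryThesis.type?_inst (I : Inst S) {c : Cls} {n : ℕ}
    (b : BdryThesis S c n) : (b.inst I).type? = b.type?.map (Expr.inst I) := by
  cases b <;> rfl

theorem BdryThesis.Over.type? {P : Cls → ℕ → ℕ → Prop} {V : ℕ → Prop} {c : Cls} {n : ℕ}
    {b : BdryThesis S c n} (hb : b.Over P V) {C : TyExpr S n} (hC : b.type? = some C) :
    C.Over P V := by
  cases b with
  | ofTy A => cases hC; exact hb
  | isTy => cases hC
  | eqTy => cases hC
  | eqTm => cases hC

/-- As `a` does not occur in `J`, the update of `σ` at `a` is felt only at the place that was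
opened. -/
theorem Jdg.act_openVar (I : Inst S) (σ : ℕ → TmExpr S 0) {P : Cls → ℕ → ℕ → Prop}
    {V : ℕ → Prop} {c : Cls} {k : ℕ} {J : Jdg S c (k + 1)} (hJ : J.Over P V) {a : ℕ} (ha : ¬ V a)
    (s : TmExpr S 0) :
    (J.openVar a).act I (Function.update σ a s) = (J.act I σ).openTm s := by
  refine (Jdg.act_openTm I _ J (.fvar a)).trans ?_
  rw [Jdg.act_congr hJ (I' := I) (τ := σ) (fun _ _ _ _ => rfl)
    fun b hb => Function.update_of_ne (fun h : b = a => ha (h ▸ hb)) _ _]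
  simp [Expr.act, Expr.weaken_zero]

theorem Bdry.act_openVar (I : Inst S) (σ : ℕ → TmExpr S 0) {P : Cls → ℕ → ℕ → Prop}
    {V : ℕ → Prop} {c : Cls} {k : ℕ} {B : Bdry S c (k + 1)} (hB : B.Over P V) {a : ℕ}
    (ha : ¬ V a) (s : TmExpr S 0) :
    (B.openVar a).act I (Function.update σ a s) = (B.act I σ).openTm s := by
  refine (Bdry.act_openTm I _ B (.fvar a)).trans ?_
  rw [Bdry.act_congr hB (J := I) (τ := σ) (fun _ _ _ _ => rfl)
    fun b hb => Function.update_of_ne (fun h : b = a => ha (h ▸ hb)) _ _]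
  simp [Expr.act, Expr.weaken_zero]

/-- The admissibility of an action on derivations follows from its admissibility at variables and
metavariables. The relation `G` between source contexts, target contexts and substitutions says
which substitutions are allowed. -/
theorem Derives.act_of {T T' : RawTheory.{u, v} S}
    (hT : ∀ {c : Cls} {R : RawRule S c}, T.HasRule R → T'.HasRule R)
    {Ξ Θ : MCtx S} {I : Inst S} (G : VCtx S → VCtx S → (ℕ → TmExpr S 0) → Prop)
    (valid : ∀ {Δ Γ σ}, G Δ Γ σ → Θ.Valid ∧ Γ.Valid Θ)
    (inst_over : ∀ {Δ Γ σ}, G Δ Γ σ → ∀ c k M, Ξ.Dom c k M → (I c k M).Over Θ.Dom Γ.Dom)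
    (var : ∀ {Δ Γ σ}, G Δ Γ σ → ∀ {a A}, (a, A) ∈ Δ →
      Derives T' Θ Γ (.jdg (.ofTy (σ a) (A.act I σ))))
    (ext : ∀ {Δ Γ σ}, G Δ Γ σ → ∀ {a b : ℕ} {A : TyExpr S 0}, ¬ Δ.Dom a → ¬ Γ.Dom b →
      A.Over Ξ.Dom Δ.Dom → Derives T' Θ Γ (.jdg (.isTy (A.act I σ))) →
      G ((a, A) :: Δ) ((b, A.act I σ) :: Γ) (Function.update σ a (.fvar b)))
    (mvar : ∀ {Δ Γ σ}, G Δ Γ σ → ∀ {c k M} {B : Bdry S c k} {t : Fin k → TmExpr S 0},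
      ⟨c, k, M, B⟩ ∈ Ξ → (∀ j, Derives T' Θ Γ (.jdg (.ofTy (t j) ((B.inst I).argType t j)))) →
      Derives T' Θ Γ (.bdry ((B.inst I).thesis.subst t).toBdry) →
      Derives T' Θ Γ (.jdg (((B.inst I).thesis.subst t).toBdry.fill ((I c k M).subst t))))
    (mvarCongr : ∀ {Δ Γ σ}, G Δ Γ σ → ∀ {o k M} {B : Bdry S (.obj o) k} {s t : Fin k → TmExpr S 0},
      ⟨.obj o, k, M, B⟩ ∈ Ξ →
      (∀ j, Derives T' Θ Γ (.jdg (.ofTy (s j) ((B.inst I).argType s j)))) →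
      (∀ j, Derives T' Θ Γ (.jdg (.ofTy (t j) ((B.inst I).argType t j)))) →
      (∀ j, Derives T' Θ Γ (.jdg (.eqTm (s j) (t j) ((B.inst I).argType s j)))) →
      (∀ C, (B.inst I).thesis.type? = some C →
        Derives T' Θ Γ (.jdg (.eqTy (C.subst s) (C.subst t)))) →
      Derives T' Θ Γ (.jdg (((B.inst I).thesis.subst s).toBdry.fillEq
        ((I (.obj o) k M).subst s) ((I (.obj o) k M).subst t))))
    {Δ Γ : VCtx S} {σ : ℕ → TmExpr S 0} {F : Form S} (h : Derives T Ξ Δ F) (hG : G Δ Γ σ) :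
    Derives T' Θ Γ (F.act I σ) := by
  have hσ {Δ Γ σ} (hG : G Δ Γ σ) (a : ℕ) (ha : Δ.Dom a) : (σ a).Over Θ.Dom Γ.Dom := by
    obtain ⟨A, h⟩ := ha
    exact (var hG h).valid.2.2.2
  induction h generalizing Γ σ with
  | var hΘ hΓ h => simpa [Form.act, Expr.act, Expr.weaken_zero] using var hG h
  | @mvar Δ c k M B t hM ht hB iht ihB =>
    have hBv := hB.valid.1.over hM
    replace iht := fun j => iht j hG
    replace ihB := ihB hG
    have e := Bdry.act_eq_inst I σ hBv
    simp only [Form.act, Jdg.act_ofTy, Bdry.act_argType, BdryThesis.toBdry_act,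
      BdryThesis.act_subst, e] at iht ihB
    have e' : B.thesis.act I σ = (B.inst I).thesis := congrArg Bdry.thesis e
    rw [e'] at ihB
    have := mvar hG hM iht ihB
    simpa only [Form.act, Jdg.act, Bdry.fill, BdryThesis.toBdry_act, BdryThesis.act_subst, e',
      act_mvarApp] using this
  | @mvarCongr Δ o k M B s t hΘ hΓ hM hs ht hst hC ihs iht ihst ihC =>
    have hBv := hΘ.over hM
    replace ihs := fun j => ihs j hG
    replace iht := fun j => iht j hG
    replace ihst := fun j => ihst j hG
    have e := Bdry.act_eq_inst I σ hBv
    have e' : B.thesis.act I σ = (B.inst I).thesis := congrArg Bdry.thesis e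
    simp only [Form.act, Jdg.act_ofTy, Jdg.act_eqTm, Jdg.act_eqTy, Bdry.act_argType, e,
      Expr.act_subst] at ihs iht ihst ihC
    have := mvarCongr hG hM ihs iht ihst
      (fun C hC => by
        rw [← e', BdryThesis.type?_act, Option.map_eq_some_iff] at hC
        obtain ⟨C, hC, rfl⟩ := hC
        exact ihC C hC hG)
    simpa only [Form.act, Jdg.act_fillEq, BdryThesis.toBdry_act, BdryThesis.act_subst, e',
      act_mvarApp] using this
  | @abstr Δ c k a J hJ hA ha h ihA ih =>
    -- The name `a` is fresh for the source context only, so the bound variable gets a new name in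
    -- the target.
    obtain ⟨b, hb⟩ := Γ.exists_fresh
    simp only [Form.act, Jdg.act_isTy] at ihA ih
    have h' := ih (ext hG ha hb hA.valid.2.2.2 (ihA hG))
    rw [Jdg.act_openVar I σ hJ ha] at h'
    exact .abstr (hJ.act (inst_over hG) (hσ hG)) (ihA hG) hb h'
  | eqTyRefl _ ih => simpa [Form.act] using Derives.eqTyRefl (by simpa [Form.act] using ih hG)
  | eqTySymm _ ih => simpa [Form.act] using Derives.eqTySymm (by simpa [Form.act] using ih hG)
  | eqTyTrans _ _ ih ih' =>
    simp only [Form.act, Jdg.act_eqTy] at ih ih' ⊢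
    exact .eqTyTrans (ih hG) (ih' hG)
  | eqTmRefl _ ih => simpa [Form.act] using Derives.eqTmRefl (by simpa [Form.act] using ih hG)
  | eqTmSymm _ ih => simpa [Form.act] using Derives.eqTmSymm (by simpa [Form.act] using ih hG)
  | eqTmTrans _ _ ih ih' =>
    simp only [Form.act, Jdg.act_eqTm] at ih ih' ⊢
    exact .eqTmTrans (ih hG) (ih' hG)
  | convTm _ _ ih ih' =>
    simp only [Form.act, Jdg.act_eqTy, Jdg.act_ofTy] at ih ih' ⊢
    exact .convTm (ih hG) (ih' hG)
  | convEqTm _ _ ih ih' =>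
    simp only [Form.act, Jdg.act_eqTy, Jdg.act_eqTm] at ih ih' ⊢
    exact .convEqTm (ih hG) (ih' hG)
  | bdryTy => simpa [Form.act, BdryThesis.act] using Derives.bdryTy (valid hG).1 (valid hG).2
  | bdryTm _ ih =>
    simp only [Form.act, Jdg.act_isTy, BdryThesis.toBdry_act] at ih ⊢
    exact .bdryTm (ih hG)
  | bdryEqTy _ _ ih ih' =>
    simp only [Form.act, Jdg.act_isTy, BdryThesis.toBdry_act] at ih ih' ⊢
    exact .bdryEqTy (ih hG) (ih' hG)
  | bdryEqTm _ _ _ ih ih' ih'' =>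
    simp only [Form.act, Jdg.act_isTy, Jdg.act_ofTy, BdryThesis.toBdry_act] at ih ih' ih'' ⊢
    exact .bdryEqTm (ih hG) (ih' hG) (ih'' hG)
  | @bdryAbstr Δ c k a B hB hA ha h ihA ih =>
    obtain ⟨b, hb⟩ := Γ.exists_fresh
    simp only [Form.act, Jdg.act_isTy] at ihA ih
    have h' := ih (ext hG ha hb hA.valid.2.2.2 (ihA hG))
    rw [Bdry.act_openVar I σ hB ha] at h'
    exact .bdryAbstr (hB.act (inst_over hG) (hσ hG)) (ihA hG) hb h'
  | @specific Δ c R K hR hI hb ihI ihb =>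
    simp only [Form.act, Jdg.act, Bdry.fill, BdryThesis.toBdry_act,
      BdryThesis.act_inst I σ K R.bdry_valid, Expr.act_inst I σ K R.head_valid] at ihI ihb ⊢
    replace ihb := ihb hG
    rw [BdryThesis.act_inst I σ K R.bdry_valid] at ihb
    refine .specific (hT hR) (fun c k M B hM => ?_) ihb
    have := ihI c k M B hM hG
    rwa [Bdry.act_inst I σ K (R.prem_valid.over hM)] at this
  | @congr Δ o R K L hΘ hΓ hR hI hJ hIJ hC ihI ihJ ihIJ ihC =>
    simp only [Form.act, Jdg.act_fillEq, Jdg.act_eqTy, BdryThesis.toBdry_act,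
      BdryThesis.act_inst I σ _ R.bdry_valid, Expr.act_inst I σ _ R.head_valid] at ihIJ ihC ⊢
    refine .congr (valid hG).1 (valid hG).2 (hT hR) (fun c k M B hM => ?_)
      (fun c k M B hM => ?_) (fun o' k M B hM => ?_) (fun C hC => ?_)
    · have := ihI c k M B hM hG
      simp only [Form.act, Jdg.act, Bdry.fill, Bdry.act_inst I σ _ (R.prem_valid.over hM)] at this
      exact this
    · have := ihJ c k M B hM hG
      simp only [Form.act, Jdg.act, Bdry.fill, Bdry.act_inst I σ _ (R.prem_valid.over hM)] at this
      exact this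
    · have := ihIJ o' k M B hM hG
      rwa [Bdry.act_inst I σ _ (R.prem_valid.over hM)] at this
    · have := ihC C hC hG
      have hCv := R.bdry_valid.type? hC
      rwa [Expr.act_inst I σ _ hCv, Expr.act_inst I σ _ hCv] at this

/-! ## Renaming and substitution -/

theorem Expr.act_id {c : Cls} {n : ℕ} (e : Expr S c n) : e.act idInst .fvar = e := by
  rw [act_fvar, inst_id]

theorem Expr.act_update (I : Inst S) (σ : ℕ → TmExpr S 0) {P : Cls → ℕ → ℕ → Prop} {V : ℕ → Prop}
    {c : Cls} {n : ℕ} {e : Expr S c n} (he : e.Over P V) {a : ℕ} (ha : ¬ V a) (s : TmExpr S 0) :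
    e.act I (Function.update σ a s) = e.act I σ :=
  act_congr he (fun _ _ _ _ => rfl)
    fun b hb => Function.update_of_ne (fun h : b = a => ha (h ▸ hb)) _ _

theorem idInst_over {P : Cls → ℕ → ℕ → Prop} {V : ℕ → Prop} {c : Cls} {k M : ℕ} (h : P c k M) :
    (idInst (S := S) c k M).Over P V := by
  cases c with
  | obj o => exact ⟨h, fun _ => trivial⟩
  | eqn o => trivial

theorem idInst_subst {n : ℕ} (c : Cls) (k M : ℕ) (t : Fin k → TmExpr S n) :
    (idInst c k M).subst t = mvarApp c M t := by
  cases c <;> rfl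

theorem VCtx.Valid.cons {Θ : MCtx S} {Γ : VCtx S} (hΓ : Γ.Valid Θ) {a : ℕ} {A : TyExpr S 0}
    (ha : ¬ Γ.Dom a) (hA : A.Over Θ.Dom Γ.Dom) : VCtx.Valid Θ ((a, A) :: Γ) := ⟨hΓ, ha, hA⟩

/-- Variables go to variables, so the variable rule settles the variable case and passing under a
binder needs no weakening; weakening is instead a consequence. The change of theory is carried along
because finitarity speaks of derivations from the preceding rules only. -/
theorem Derives.rename {T T' : RawTheory.{u, v} S}
    (hT : ∀ {c : Cls} {R : RawRule S c}, T.HasRule R → T'.HasRule R) {Θ : MCtx S} {Δ Γ : VCtx S}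
    {F : Form S} (h : Derives T Θ Δ F) {σ : ℕ → TmExpr S 0} (hΓ : Γ.Valid Θ)
    (hσ : ∀ a A, (a, A) ∈ Δ → ∃ b, σ a = .fvar b ∧ (b, A.act idInst σ) ∈ Γ) :
    Derives T' Θ Γ (F.act idInst σ) := by
  refine h.act_of hT (fun Δ Γ σ => Θ.Valid ∧ Δ.Valid Θ ∧ Γ.Valid Θ ∧
    ∀ a A, (a, A) ∈ Δ → ∃ b, σ a = .fvar b ∧ (b, A.act idInst σ) ∈ Γ) ?_ ?_ ?_ ?_ ?_ ?_
    ⟨h.valid.1, h.valid.2.1, hΓ, hσ⟩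
  · exact fun hG => ⟨hG.1, hG.2.2.1⟩
  · exact fun hG c k M => idInst_over
  · intro Δ Γ σ ⟨hΘ, hΔ, hΓ, hσ⟩ a A hA
    obtain ⟨b, hb, hbA⟩ := hσ a A hA
    rw [hb]
    exact .var hΘ hΓ hbA
  · intro Δ Γ σ ⟨hΘ, hΔ, hΓ, hσ⟩ a b A ha hb hA h
    refine ⟨hΘ, hΔ.cons ha hA, hΓ.cons hb h.valid.2.2.2, fun c C hC => ?_⟩
    rcases List.mem_cons.1 hC with e | hC
    · cases e
      rw [Expr.act_update _ _ hA ha]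
      exact ⟨b, by simp, List.mem_cons_self⟩
    · rw [Expr.act_update _ _ (hΔ.over hC) ha,
        Function.update_of_ne (fun e : c = a => ha (e ▸ ⟨C, hC⟩))]
      obtain ⟨b', hb', h'⟩ := hσ c C hC
      exact ⟨b', hb', List.mem_cons_of_mem _ h'⟩
  · intro Δ Γ σ hG c k M B t hM ht hB
    simp only [Bdry.inst_id, idInst_subst] at ht hB ⊢
    exact .mvar hM ht hB
  · intro Δ Γ σ ⟨hΘ, _, hΓ, _⟩ o k M B s t hM hs ht hst hC
    simp only [Bdry.inst_id, idInst_subst] at hs ht hst hC ⊢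
    exact .mvarCongr hΘ hΓ hM hs ht hst hC

theorem Derives.weaken_theory {T T' : RawTheory.{u, v} S}
    (hT : ∀ {c : Cls} {R : RawRule S c}, T.HasRule R → T'.HasRule R) {Θ : MCtx S} {Γ : VCtx S}
    {F : Form S} (h : Derives T Θ Γ F) : Derives T' Θ Γ F := by
  rw [← F.act_id]
  exact h.rename hT h.valid.2.1 fun a A hA => ⟨a, rfl, by rwa [Expr.act_id]⟩

variable {T : RawTheory.{u, v} S}

theorem Derives.weaken {Θ : MCtx S} {Γ Γ' : VCtx S} {F : Form S} (h : Derives T Θ Γ F)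
    (hΓ : Γ'.Valid Θ) (hs : Γ ⊆ Γ') : Derives T Θ Γ' F := by
  rw [← F.act_id]
  exact h.rename (fun h => h) hΓ fun a A hA => ⟨a, rfl, by rw [Expr.act_id]; exact hs hA⟩

/-- The substitution `σ`, together with `I`, maps variables of `Ξ; Δ` to derivable terms
over `Θ; Γ`. -/
structure IsSubst (T : RawTheory.{u, v} S) (Ξ Θ : MCtx S) (I : Inst S) (Δ Γ : VCtx S)
    (σ : ℕ → TmExpr S 0) : Prop where
  mctx : Θ.Valid
  source : Δ.Valid Ξ
  target : Γ.Valid Θ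
  var : ∀ {a A}, (a, A) ∈ Δ → Derives T Θ Γ (.jdg (.ofTy (σ a) (A.act I σ)))

namespace IsSubst

variable {Ξ Θ : MCtx S} {I : Inst S} {Δ Γ : VCtx S} {σ : ℕ → TmExpr S 0}

theorem weaken (h : IsSubst T Ξ Θ I Δ Γ σ) {Γ' : VCtx S} (hΓ : Γ'.Valid Θ) (hs : Γ ⊆ Γ') :
    IsSubst T Ξ Θ I Δ Γ' σ :=
  ⟨h.mctx, h.source, hΓ, fun hA => (h.var hA).weaken hΓ hs⟩

theorem extend (h : IsSubst T Ξ Θ I Δ Γ σ) {a : ℕ} {A : TyExpr S 0} (ha : ¬ Δ.Dom a)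
    (hA : A.Over Ξ.Dom Δ.Dom) {s : TmExpr S 0}
    (hs : Derives T Θ Γ (.jdg (.ofTy s (A.act I σ)))) :
    IsSubst T Ξ Θ I ((a, A) :: Δ) Γ (Function.update σ a s) := by
  refine ⟨h.mctx, h.source.cons ha hA, h.target, fun {c C} hC => ?_⟩
  rcases List.mem_cons.1 hC with e | hC
  · cases e
    rw [Expr.act_update _ _ hA ha]
    simpa using hs
  · rw [Expr.act_update _ _ (h.source.over hC) ha,
      Function.update_of_ne (fun e : c = a => ha (e ▸ ⟨C, hC⟩))]
    exact h.var hC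

/-- Under a binder the old values are weakened to the extended target context, and the bound
variable is sent to the new one. -/
theorem lift (h : IsSubst T Ξ Θ I Δ Γ σ) {a b : ℕ} {A : TyExpr S 0} (ha : ¬ Δ.Dom a)
    (hb : ¬ Γ.Dom b) (hA : A.Over Ξ.Dom Δ.Dom) (hA' : Derives T Θ Γ (.jdg (.isTy (A.act I σ)))) :
    IsSubst T Ξ Θ I ((a, A) :: Δ) ((b, A.act I σ) :: Γ) (Function.update σ a (.fvar b)) := by
  have hΓ := h.target.cons hb hA'.valid.2.2.2
  exact (h.weaken hΓ (List.subset_cons_self _ _)).extend ha hA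
    (.var h.mctx hΓ List.mem_cons_self)

theorem id {Θ : MCtx S} {Γ : VCtx S} (hΘ : Θ.Valid) (hΓ : Γ.Valid Θ) :
    IsSubst T Θ Θ idInst Γ Γ .fvar :=
  ⟨hΘ, hΓ, hΓ, fun hA => by rw [Expr.act_id]; exact .var hΘ hΓ hA⟩

end IsSubst

theorem Derives.subst {Θ : MCtx S} {Δ Γ : VCtx S} {σ : ℕ → TmExpr S 0} {F : Form S}
    (h : Derives T Θ Δ F) (hσ : IsSubst T Θ Θ idInst Δ Γ σ) :
    Derives T Θ Γ (F.act idInst σ) := by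
  refine h.act_of (fun h => h) (IsSubst T Θ Θ idInst) ?_ ?_ ?_ ?_ ?_ ?_ hσ
  · exact fun hG => ⟨hG.mctx, hG.target⟩
  · exact fun hG c k M => idInst_over
  · exact fun hG => hG.var
  · exact fun hG => hG.lift
  · intro Δ Γ σ hG c k M B t hM ht hB
    simp only [Bdry.inst_id, idInst_subst] at ht hB ⊢
    exact .mvar hM ht hB
  · intro Δ Γ σ hG o k M B s t hM hs ht hst hC
    simp only [Bdry.inst_id, idInst_subst] at hs ht hst hC ⊢
    exact .mvarCongr hG.mctx hG.target hM hs ht hst hC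

/-! ## Inversion -/

theorem Derives.abstr_inv {Θ : MCtx S} {Γ : VCtx S} {c : Cls} {k : ℕ} {J : Jdg S c (k + 1)}
    (h : Derives T Θ Γ (.jdg J)) :
    J.Over Θ.Dom Γ.Dom ∧ Derives T Θ Γ (.jdg (.isTy J.bdry.headType)) ∧
      ∃ a, ¬ Γ.Dom a ∧ Derives T Θ ((a, J.bdry.headType) :: Γ) (.jdg (J.openVar a)) := by
  cases h with
  | abstr hJ hA ha h => exact ⟨hJ, hA, _, ha, h⟩

theorem Derives.bdryAbstr_inv {Θ : MCtx S} {Γ : VCtx S} {c : Cls} {k : ℕ} {B : Bdry S c (k + 1)}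
    (h : Derives T Θ Γ (.bdry B)) :
    B.Over Θ.Dom Γ.Dom ∧ Derives T Θ Γ (.jdg (.isTy B.headType)) ∧
      ∃ a, ¬ Γ.Dom a ∧ Derives T Θ ((a, B.headType) :: Γ) (.bdry (B.openVar a)) := by
  cases h with
  | bdryAbstr hJ hA ha h => exact ⟨hJ, hA, _, ha, h⟩

/-- What the derivability of a boundary says about the components of its thesis. -/
def BdryThesis.Components (T : RawTheory.{u, v} S) (Θ : MCtx S) (Γ : VCtx S) {c : Cls} :
    BdryThesis S c 0 → Prop
  | .isTy => True
  | .ofTy A => Derives T Θ Γ (.jdg (.isTy A))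
  | .eqTy A B => Derives T Θ Γ (.jdg (.isTy A)) ∧ Derives T Θ Γ (.jdg (.isTy B))
  | .eqTm s t A => Derives T Θ Γ (.jdg (.isTy A)) ∧ Derives T Θ Γ (.jdg (.ofTy s A)) ∧
      Derives T Θ Γ (.jdg (.ofTy t A))

/-- The form is kept general because case analysis on a derivation needs its index to be a variable.
With no abstractions, only the rule for the given shape of thesis can conclude. -/
theorem Derives.components_aux {Θ : MCtx S} {Γ : VCtx S} {F : Form S} (h : Derives T Θ Γ F) :
    match F with
    | .bdry (k := 0) B => B.thesis.Components T Θ Γ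
    | _ => True := by
  cases h <;> trivial

theorem Derives.components {Θ : MCtx S} {Γ : VCtx S} {c : Cls} {b : BdryThesis S c 0}
    (h : Derives T Θ Γ (.bdry b.toBdry)) : b.Components T Θ Γ :=
  h.components_aux

theorem BdryThesis.Components.derives {Θ : MCtx S} {Γ : VCtx S} {c : Cls} {b : BdryThesis S c 0}
    (hΘ : Θ.Valid) (hΓ : Γ.Valid Θ) (h : b.Components T Θ Γ) :
    Derives T Θ Γ (.bdry b.toBdry) := by
  cases b with
  | isTy => exact .bdryTy hΘ hΓ
  | ofTy A => exact .bdryTm h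
  | eqTy A B => exact .bdryEqTy h.1 h.2
  | eqTm s t A => exact .bdryEqTm h.1 h.2.1 h.2.2

/-! ## Substitution into abstracted judgements -/

theorem Derives.openTm {Θ : MCtx S} {Γ : VCtx S} {c : Cls} {k : ℕ} {J : Jdg S c (k + 1)}
    (h : Derives T Θ Γ (.jdg J)) {s : TmExpr S 0}
    (hs : Derives T Θ Γ (.jdg (.ofTy s J.bdry.headType))) :
    Derives T Θ Γ (.jdg (J.openTm s)) := by
  obtain ⟨hJ, hA, a, ha, h⟩ := h.abstr_inv
  have := h.subst ((IsSubst.id hs.valid.1 hs.valid.2.1).extend ha hA.valid.2.2.2 (by rwa [Expr.act_id]))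
  rwa [Form.act, Jdg.act_openVar _ _ hJ ha, Jdg.act_id] at this

/-- Each step consumes the outermost abstraction with the first argument; the types expected of the
remaining arguments are unchanged by `Bdry.argType_openTm`. -/
theorem Derives.substArgs {Θ : MCtx S} {Γ : VCtx S} {c : Cls} {k : ℕ} {J : Jdg S c k}
    (h : Derives T Θ Γ (.jdg J)) {t : Fin k → TmExpr S 0}
    (ht : ∀ j, Derives T Θ Γ (.jdg (.ofTy (t j) (J.bdry.argType t j)))) :
    Derives T Θ Γ (.jdg ((J.bdry.thesis.subst t).toBdry.fill (J.head.subst t))) := by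
  induction k with
  | zero =>
    have ht : t = Expr.bvar := funext fun i => i.elim0
    rw [ht, Expr.subst_bvar, BdryThesis.subst_bvar, ← Bdry.eq_toBdry]
    exact h
  | succ k ih =>
    have h0 := ht 0
    rw [Bdry.argType_zero] at h0
    have := ih (h.openTm h0) (t := fun j => t j.succ) fun j => by
      have := ht j.succ
      rwa [← Bdry.argType_openTm] at this
    simpa only [Jdg.openTm, Bdry.openTm, BdryThesis.subst_openTm, Expr.subst_openTm] using this

/-! ## Presuppositivity -/

theorem IsVCtx.valid {Θ : MCtx S} {Γ : VCtx S} (h : IsVCtx T Θ Γ) : Γ.Valid Θ := by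
  cases h with
  | nil => trivial
  | cons _ hA ha => exact hA.valid.2.1.cons ha hA.valid.2.2.2

theorem IsVCtx.derives {Θ : MCtx S} {Γ : VCtx S} (h : IsVCtx T Θ Γ) {a : ℕ} {A : TyExpr S 0}
    (hA : (a, A) ∈ Γ) : Derives T Θ Γ (.jdg (.isTy A)) := by
  induction h with
  | nil => cases hA
  | cons hΓ hB hb ih =>
    have hv := (IsVCtx.cons hΓ hB hb).valid
    rcases List.mem_cons.1 hA with e | hA
    · cases e
      exact hB.weaken hv (List.subset_cons_self _ _)
    · exact (ih hA).weaken hv (List.subset_cons_self _ _)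

/-- Presuppositivity is proved by induction on derivations, which also pass through boundaries; for
these the claim is the given derivation. -/
def Form.toBdry : Form S → Form S
  | .jdg J => .bdry J.bdry
  | .bdry B => .bdry B

theorem Derives.presup_aux {Θ : MCtx S} {Γ : VCtx S} {F : Form S} (h : Derives T Θ Γ F)
    (hΓ : IsVCtx T Θ Γ) : Derives T Θ Γ F.toBdry := by
  -- Common to both kinds of congruence rule: the two sides come typed in two different instances of
  -- a boundary, whose types are equal.
  have key {Γ : VCtx S} {o : Kind} {b b' : BdryThesis S (.obj o) 0} {s t : Expr S (.obj o) 0}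
      (hΘ : Θ.Valid) (hΓ : Γ.Valid Θ)
      (hC : b.type? = none ∧ b'.type? = none ∨ ∃ C C', b.type? = some C ∧ b'.type? = some C' ∧
        Derives T Θ Γ (.jdg (.eqTy C C')) ∧ Derives T Θ Γ (.bdry (BdryThesis.eqTy C C').toBdry))
      (hs : b.Components T Θ Γ → Derives T Θ Γ (.jdg (b.toBdry.fill s)))
      (ht : b'.Components T Θ Γ → Derives T Θ Γ (.jdg (b'.toBdry.fill t))) :
      Derives T Θ Γ (.bdry (b.eqBdry s t).toBdry) := by
    refine BdryThesis.Components.derives hΘ hΓ ?_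
    cases b with
    | isTy => cases b'; exact ⟨hs trivial, ht trivial⟩
    | ofTy C =>
      cases b' with
      | ofTy C' =>
        rcases hC with ⟨h, -⟩ | ⟨_, _, h, h', hC, hCC⟩
        · cases h
        · cases h; cases h'
          have := hCC.components
          -- The right-hand side has type `C'`, but the equation boundary wants it at `C`.
          exact ⟨this.1, hs this.1, (ht this.2).convTm hC.eqTySymm⟩
  induction h with
  | var hΘ _ h => exact .bdryTm (hΓ.derives h)
  | mvar _ _ hB => exact hB
  | @mvarCongr Γ o k M B s t hΘ hΓ' hM hs ht hst hC ihs iht ihst ihC =>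
    refine key (b' := B.thesis.subst t) hΘ hΓ' ?_ (fun h => .mvar hM hs (h.derives hΘ hΓ'))
      (fun h => .mvar hM ht (h.derives hΘ hΓ'))
    generalize B.thesis = b at hC ihC
    cases b with
    | isTy => exact .inl ⟨rfl, rfl⟩
    | ofTy C => exact .inr ⟨_, _, rfl, rfl, hC C rfl, ihC C rfl hΓ⟩
  | abstr hJ hA ha h ihA ih => exact .bdryAbstr hJ.1 hA ha (ih (.cons hΓ hA ha))
  | eqTyRefl h => exact .bdryEqTy h h
  | eqTySymm _ ih => exact have h := (ih hΓ).components; .bdryEqTy h.2 h.1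
  | eqTyTrans _ _ ih ih' => exact .bdryEqTy (ih hΓ).components.1 (ih' hΓ).components.2
  | eqTmRefl h ih => exact .bdryEqTm (ih hΓ).components h h
  | eqTmSymm _ ih => exact have h := (ih hΓ).components; .bdryEqTm h.1 h.2.2 h.2.1
  | eqTmTrans _ _ ih ih' =>
    exact have h := (ih hΓ).components; .bdryEqTm h.1 h.2.1 (ih' hΓ).components.2.2
  | convTm _ _ _ ih => exact .bdryTm (ih hΓ).components.2
  | convEqTm _ h ih ih' =>
    exact have h' := (ih hΓ).components
      .bdryEqTm (ih' hΓ).components.2 (.convTm h'.2.1 h) (.convTm h'.2.2 h)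
  | bdryTy h h' => exact .bdryTy h h'
  | bdryTm h => exact .bdryTm h
  | bdryEqTy h h' => exact .bdryEqTy h h'
  | bdryEqTm h h' h'' => exact .bdryEqTm h h' h''
  | bdryAbstr hB hA ha h => exact .bdryAbstr hB hA ha h
  | specific _ _ hb => exact hb
  | @congr Γ o R I J hΘ hΓ' hR hI hJ hIJ hC ihI ihJ ihIJ ihC =>
    refine key (b' := R.bdry.inst J) hΘ hΓ' ?_ (fun h => .specific hR hI (h.derives hΘ hΓ'))
      (fun h => .specific hR hJ (h.derives hΘ hΓ'))
    generalize R.bdry = b at hC ihC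
    cases b with
    | isTy => exact .inl ⟨rfl, rfl⟩
    | ofTy C => exact .inr ⟨_, _, rfl, rfl, hC C rfl, ihC C rfl hΓ⟩

/-- Presuppositivity: the boundary of a derivable judgement is derivable. -/
theorem Derives.presup {Θ : MCtx S} {Γ : VCtx S} {c : Cls} {k : ℕ} {J : Jdg S c k}
    (h : Derives T Θ Γ (.jdg J)) (hΓ : IsVCtx T Θ Γ) : Derives T Θ Γ (.bdry J.bdry) :=
  h.presup_aux hΓ

/-- Without abstractions this is presuppositivity of the equation; abstractions are opened and
closed again around it. -/
theorem Derives.fill_of_fillEq {Θ : MCtx S} {Γ : VCtx S} {o : Kind} {k : ℕ}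
    {B : Bdry S (.obj o) k} {s t : Expr S (.obj o) k} (h : Derives T Θ Γ (.jdg (B.fillEq s t)))
    (hΓ : IsVCtx T Θ Γ) :
    Derives T Θ Γ (.jdg (B.fill s)) ∧ Derives T Θ Γ (.jdg (B.fill t)) := by
  induction k generalizing Γ with
  | zero =>
    rw [B.eq_toBdry]
    have h := h.presup hΓ
    rw [Bdry.eq_toBdry (Jdg.bdry _)] at h
    have h := h.components
    rcases B with ⟨A, b⟩
    cases b with
    | isTy => exact h
    | ofTy C => exact h.2
  | succ k ih =>
    obtain ⟨hJ, hA, a, ha, h⟩ := h.abstr_inv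
    have e : (B.fillEq s t).openVar a = (B.openVar a).fillEq (s.openVar a) (t.openVar a) :=
      B.fillEq_openTm s t (.fvar a)
    rw [e] at h
    have h' := ih h (.cons hΓ hA ha)
    have hv : B.Over Θ.Dom Γ.Dom ∧ s.Over Θ.Dom Γ.Dom ∧ t.Over Θ.Dom Γ.Dom := by
      have h1 := hJ.1.1
      have h2 := hJ.1.2
      rcases B with ⟨A, b⟩
      cases b with
      | isTy => exact ⟨⟨h1, trivial⟩, h2⟩
      | ofTy C => exact ⟨⟨h1, h2.2.2⟩, h2.1, h2.2.1⟩
    exact ⟨.abstr ⟨hv.1, hv.2.1⟩ hA ha h'.1, .abstr ⟨hv.1, hv.2.2⟩ hA ha h'.2⟩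

/-! ## Equal substitutions -/

theorem Expr.act_openVar (I : Inst S) (σ : ℕ → TmExpr S 0) {P : Cls → ℕ → ℕ → Prop}
    {V : ℕ → Prop} {c : Cls} {k : ℕ} {e : Expr S c (k + 1)} (he : e.Over P V) {a : ℕ}
    (ha : ¬ V a) (s : TmExpr S 0) :
    (e.openVar a).act I (Function.update σ a s) = (e.act I σ).openTm s := by
  refine (Expr.act_openTm I _ e (.fvar a)).trans ?_
  rw [Expr.act_update _ _ he ha]
  simp [Expr.act, Expr.weaken_zero]

theorem BdryThesis.subst_eqBdry {o : Kind} {n m : ℕ} (b : BdryThesis S (.obj o) n)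
    (s t : Expr S (.obj o) n) (β : Fin n → TmExpr S m) :
    (b.eqBdry s t).subst β = (b.subst β).eqBdry (s.subst β) (t.subst β) := by
  cases b <;> rfl

theorem Derives.fillEq_trans {Θ : MCtx S} {Γ : VCtx S} {o : Kind} {b : BdryThesis S (.obj o) 0}
    {e₁ e₂ e₃ : Expr S (.obj o) 0} (h : Derives T Θ Γ (.jdg (b.toBdry.fillEq e₁ e₂)))
    (h' : Derives T Θ Γ (.jdg (b.toBdry.fillEq e₂ e₃))) :
    Derives T Θ Γ (.jdg (b.toBdry.fillEq e₁ e₃)) := by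
  cases b with
  | isTy => exact .eqTyTrans h h'
  | ofTy C => exact .eqTmTrans h h'

/-- `(I, σ)` and `(J, τ)` map variables of `Ξ; Δ` to judgementally equal terms over `Θ; Γ`. -/
structure IsEqSubst (T : RawTheory.{u, v} S) (Ξ Θ : MCtx S) (I J : Inst S) (Δ Γ : VCtx S)
    (σ τ : ℕ → TmExpr S 0) : Prop where
  left : IsSubst T Ξ Θ I Δ Γ σ
  right : IsSubst T Ξ Θ J Δ Γ τ
  var : ∀ {a A}, (a, A) ∈ Δ → Derives T Θ Γ (.jdg (.eqTm (σ a) (τ a) (A.act I σ)))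

namespace IsEqSubst

variable {Ξ Θ : MCtx S} {I J : Inst S} {Δ Γ : VCtx S} {σ τ : ℕ → TmExpr S 0}

theorem weaken (h : IsEqSubst T Ξ Θ I J Δ Γ σ τ) {Γ' : VCtx S} (hΓ : Γ'.Valid Θ) (hs : Γ ⊆ Γ') :
    IsEqSubst T Ξ Θ I J Δ Γ' σ τ :=
  ⟨h.left.weaken hΓ hs, h.right.weaken hΓ hs, fun hA => (h.var hA).weaken hΓ hs⟩

theorem extend (h : IsEqSubst T Ξ Θ I J Δ Γ σ τ) {a : ℕ} {A : TyExpr S 0} (ha : ¬ Δ.Dom a)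
    (hA : A.Over Ξ.Dom Δ.Dom) {s t : TmExpr S 0}
    (hs : Derives T Θ Γ (.jdg (.ofTy s (A.act I σ))))
    (ht : Derives T Θ Γ (.jdg (.ofTy t (A.act J τ))))
    (hst : Derives T Θ Γ (.jdg (.eqTm s t (A.act I σ)))) :
    IsEqSubst T Ξ Θ I J ((a, A) :: Δ) Γ (Function.update σ a s) (Function.update τ a t) := by
  refine ⟨h.left.extend ha hA hs, h.right.extend ha hA ht, fun {c C} hC => ?_⟩
  rcases List.mem_cons.1 hC with e | hC
  · cases e
    rw [Expr.act_update _ _ hA ha]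
    simpa using hst
  · have hc : c ≠ a := fun e : c = a => ha (e ▸ ⟨C, hC⟩)
    rw [Expr.act_update _ _ (h.left.source.over hC) ha, Function.update_of_ne hc,
      Function.update_of_ne hc]
    exact h.var hC

/-- One fresh variable serves on both sides, since conversion along the equality of the two types
gives it the second type as well. -/
theorem extend_fvar (h : IsEqSubst T Ξ Θ I J Δ Γ σ τ) {a b : ℕ} {A : TyExpr S 0} (ha : ¬ Δ.Dom a)
    (hA : A.Over Ξ.Dom Δ.Dom) (hs : Derives T Θ Γ (.jdg (.ofTy (.fvar b) (A.act I σ))))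
    (hA' : Derives T Θ Γ (.jdg (.eqTy (A.act I σ) (A.act J τ)))) :
    IsEqSubst T Ξ Θ I J ((a, A) :: Δ) Γ (Function.update σ a (.fvar b))
      (Function.update τ a (.fvar b)) :=
  h.extend ha hA hs (hs.convTm hA') hs.eqTmRefl

theorem id {Θ : MCtx S} {Γ : VCtx S} (hΘ : Θ.Valid) (hΓ : Γ.Valid Θ) :
    IsEqSubst T Θ Θ idInst idInst Γ Γ .fvar .fvar :=
  ⟨.id hΘ hΓ, .id hΘ hΓ, fun hA => ((IsSubst.id hΘ hΓ).var hA).eqTmRefl⟩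

end IsEqSubst

/-- The two actions on `F` have judgementally equal results. -/
def Form.ActEq (T : RawTheory.{u, v} S) (Θ : MCtx S) (I J : Inst S) (Γ : VCtx S)
    (σ τ : ℕ → TmExpr S 0) : Form S → Prop
  | @Form.jdg _ (.obj _) _ K =>
    Derives T Θ Γ (.jdg ((K.bdry.act I σ).fillEq (K.head.act I σ) (K.head.act J τ)))
  | @Form.jdg _ (.eqn _) _ _ => True
  | @Form.bdry _ _ 0 B => ∀ C, B.thesis.type? = some C →
    Derives T Θ Γ (.jdg (.eqTy (C.act I σ) (C.act J τ)))
  | @Form.bdry _ _ (_ + 1) _ => True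

theorem Form.actEq_toBdry {Θ : MCtx S} {I J : Inst S} {Γ : VCtx S} {σ τ : ℕ → TmExpr S 0} {o : Kind}
    {b : BdryThesis S (.obj o) 0} {e : Expr S (.obj o) 0} :
    Form.ActEq T Θ I J Γ σ τ (.jdg (b.toBdry.fill e)) ↔
      Derives T Θ Γ (.jdg ((b.act I σ).toBdry.fillEq (e.act I σ) (e.act J τ))) := by
  rw [← BdryThesis.toBdry_act]; rfl

theorem Form.actEq_isTy {Θ : MCtx S} {I J : Inst S} {Γ : VCtx S} {σ τ : ℕ → TmExpr S 0}
    {A : TyExpr S 0} :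
    Form.ActEq T Θ I J Γ σ τ (.jdg (.isTy A)) ↔
      Derives T Θ Γ (.jdg (.eqTy (A.act I σ) (A.act J τ))) :=
  Form.actEq_toBdry

theorem Form.actEq_ofTy {Θ : MCtx S} {I J : Inst S} {Γ : VCtx S} {σ τ : ℕ → TmExpr S 0}
    {t : TmExpr S 0} {A : TyExpr S 0} :
    Form.ActEq T Θ I J Γ σ τ (.jdg (.ofTy t A)) ↔
      Derives T Θ Γ (.jdg (.eqTm (t.act I σ) (t.act J τ) (A.act I σ))) :=
  Form.actEq_toBdry

/-- The judgemental equality of the results of two actions on derivations follows from the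
equality at metavariables. -/
theorem Derives.actEq_of {Ξ Θ : MCtx S} {I J : Inst S} (P : VCtx S → Prop)
    (ext : ∀ {Γ}, P Γ → ∀ {b A}, ¬ Γ.Dom b → Derives T Θ Γ (.jdg (.isTy A)) → P ((b, A) :: Γ))
    (left : ∀ {Δ Γ σ F}, P Γ → IsSubst T Ξ Θ I Δ Γ σ → Derives T Ξ Δ F →
      Derives T Θ Γ (F.act I σ))
    (right : ∀ {Δ Γ σ F}, P Γ → IsSubst T Ξ Θ J Δ Γ σ → Derives T Ξ Δ F →
      Derives T Θ Γ (F.act J σ))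
    (mvar : ∀ {Γ}, P Γ → ∀ {o k M} {B : Bdry S (.obj o) k} {s t : Fin k → TmExpr S 0},
      ⟨.obj o, k, M, B⟩ ∈ Ξ →
      (∀ j, Derives T Θ Γ (.jdg (.ofTy (s j) ((B.inst I).argType s j)))) →
      (∀ j, Derives T Θ Γ (.jdg (.ofTy (t j) ((B.inst J).argType t j)))) →
      (∀ j, Derives T Θ Γ (.jdg (.eqTm (s j) (t j) ((B.inst I).argType s j)))) →
      (∀ C, B.thesis.type? = some C →
        Derives T Θ Γ (.jdg (.eqTy ((C.inst I).subst s) ((C.inst J).subst t)))) →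
      Derives T Θ Γ (.jdg (((B.inst I).thesis.subst s).toBdry.fillEq
        ((I (.obj o) k M).subst s) ((J (.obj o) k M).subst t))))
    {Δ Γ : VCtx S} {σ τ : ℕ → TmExpr S 0} {F : Form S} (h : Derives T Ξ Δ F) (hP : P Γ)
    (hστ : IsEqSubst T Ξ Θ I J Δ Γ σ τ) : F.ActEq T Θ I J Γ σ τ := by
  induction h generalizing Γ σ τ with
  | var hΘ hΓ h =>
    rw [Form.actEq_ofTy]
    simpa [Expr.act, Expr.weaken_zero] using hστ.var h
  | @mvar Δ c k M B t hM ht hB iht ihB =>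
    cases c with
    | eqn o => trivial
    | obj o =>
      have hBv := hB.valid.1.over hM
      have e := Bdry.act_eq_inst I σ hBv
      have e' : B.thesis.act I σ = (B.inst I).thesis := congrArg Bdry.thesis e
      rw [Form.actEq_toBdry, BdryThesis.act_subst, act_mvarApp, act_mvarApp, e']
      refine mvar hP hM (fun j => ?_) (fun j => ?_) (fun j => ?_) (fun C hC => ?_)
      · have := left hP hστ.left (ht j)
        rwa [Form.act, Jdg.act_ofTy, Bdry.act_argType, e] at this
      · have := right hP hστ.right (ht j)
        rwa [Form.act, Jdg.act_ofTy, Bdry.act_argType, Bdry.act_eq_inst J τ hBv] at this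
      · have := iht j hP hστ
        rwa [Form.actEq_ofTy, Bdry.act_argType, e] at this
      · have := ihB hP hστ (C.subst t) (by
          change (B.thesis.subst t).type? = _
          generalize B.thesis = b at hC
          cases b <;> cases hC
          rfl)
        have hCv := hBv.2.type? hC
        rwa [Expr.act_subst, Expr.act_subst, Expr.act_eq_inst I σ hCv,
          Expr.act_eq_inst J τ hCv] at this
  | mvarCongr => trivial
  | @abstr Δ c k a K hK hA ha h ihA ih =>
    cases c with
    | eqn o => trivial
    | obj o =>
      obtain ⟨b, hb⟩ := Γ.exists_fresh
      have hA' := left hP hστ.left hA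
      rw [Form.act, Jdg.act_isTy] at hA'
      have hAA := Form.actEq_isTy.1 (ihA hP hστ)
      have hΓ := hστ.left.target.cons hb hA'.valid.2.2.2
      have hAv := hA.valid.2.2.2
      have hs := List.subset_cons_self (b, K.bdry.headType.act I σ) Γ
      -- The conclusion is abstracted over the left instance of the type, so the new variable is
      -- declared with that type.
      have hG := (hστ.weaken hΓ hs).extend_fvar ha hAv (.var hστ.left.mctx hΓ List.mem_cons_self)
        (hAA.weaken hΓ hs)
      have h' := ih (ext hP hb hA') hG
      have l := (left hP hστ.left (.abstr hK hA ha h)).valid.2.2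
      have r := (right hP hστ.right (.abstr hK hA ha h)).valid.2.2
      refine .abstr ⟨⟨l.1.1, ?_⟩, trivial⟩ hA' hb ?_
      · have h1 := l.1.2
        have h2 := l.2
        have h3 := r.2
        rcases K with ⟨⟨A, b⟩, e⟩
        cases b with
        | isTy => exact ⟨h2, h3⟩
        | ofTy C => exact ⟨h2, h3, h1⟩
      · refine cast (congrArg (fun K => Derives T Θ _ (.jdg K)) ?_) h'
        refine Eq.trans ?_ (Bdry.fillEq_openTm (K.bdry.act I σ) _ _ (.fvar b)).symm
        rw [← Bdry.act_openVar I σ hK.1 ha, ← Expr.act_openVar I σ hK.2 ha,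
          ← Expr.act_openVar J τ hK.2 ha]
        rfl
  | eqTyRefl => trivial
  | eqTySymm => trivial
  | eqTyTrans => trivial
  | eqTmRefl => trivial
  | eqTmSymm => trivial
  | eqTmTrans => trivial
  | convTm _ h ih _ =>
    rw [Form.actEq_ofTy]
    have := left hP hστ.left h
    rw [Form.act, Jdg.act_eqTy] at this
    exact .convEqTm (Form.actEq_ofTy.1 (ih hP hστ)) this
  | convEqTm => trivial
  | bdryTy => exact fun _ h => nomatch h
  | bdryTm _ ih => rintro _ ⟨⟩; exact Form.actEq_isTy.1 (ih hP hστ)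
  | bdryEqTy => exact fun _ h => nomatch h
  | bdryEqTm => exact fun _ h => nomatch h
  | bdryAbstr => trivial
  | @specific Δ c R K hR hI hb ihI ihb =>
    cases c with
    | eqn o => trivial
    | obj o =>
      rw [Form.actEq_toBdry, BdryThesis.act_inst _ _ _ R.bdry_valid,
        Expr.act_inst _ _ _ R.head_valid, Expr.act_inst _ _ _ R.head_valid]
      refine .congr hστ.left.mctx hστ.left.target hR (fun c k M B hM => ?_)
        (fun c k M B hM => ?_) (fun o' k M B hM => ?_) (fun C hC => ?_)
      · have := left hP hστ.left (hI c k M B hM)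
        simp only [Form.act, Jdg.act, Bdry.fill, Bdry.act_inst I σ _ (R.prem_valid.over hM)] at this
        exact this
      · have := right hP hστ.right (hI c k M B hM)
        simp only [Form.act, Jdg.act, Bdry.fill, Bdry.act_inst J τ _ (R.prem_valid.over hM)] at this
        exact this
      · have : Derives _ _ _ _ := ihI (.obj o') k M B hM hP hστ
        rwa [Bdry.fill, Bdry.act_inst I σ _ (R.prem_valid.over hM)] at this
      · have := ihb hP hστ (C.inst K) (by
          change (R.bdry.inst K).type? = _
          rw [BdryThesis.type?_inst, hC]; rfl)
        have hCv := R.bdry_valid.type? hC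
        rwa [Expr.act_inst _ _ _ hCv, Expr.act_inst _ _ _ hCv] at this
  | congr => trivial

theorem Derives.substEq {Θ : MCtx S} {Δ Γ : VCtx S} {σ τ : ℕ → TmExpr S 0} {F : Form S}
    (h : Derives T Θ Δ F) (hστ : IsEqSubst T Θ Θ idInst idInst Δ Γ σ τ) :
    F.ActEq T Θ idInst idInst Γ σ τ := by
  refine h.actEq_of (fun Γ => Γ.Valid Θ) ?_ (fun _ hσ h => h.subst hσ) (fun _ hσ h => h.subst hσ)
    ?_ hστ.left.target hστ
  · exact fun hΓ _ _ hb hA => hΓ.cons hb hA.valid.2.2.2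
  · intro Γ hΓ o k M B s t hM hs ht hst hC
    simp only [Bdry.inst_id, idInst_subst, Expr.inst_id] at hs ht hst hC ⊢
    exact .mvarCongr hστ.left.mctx hΓ hM hs ht hst hC

/-- The two sides receive different arguments, so the abstraction cannot be opened with one term.
Instead it is opened with a variable in the source, and the two arguments are absorbed into `σ` and
`τ`; hence the induction varies the source context and both substitutions. -/
theorem Derives.substArgsEq {Θ : MCtx S} {Δ Γ : VCtx S} {σ τ : ℕ → TmExpr S 0} {o : Kind} {k : ℕ}
    {K : Jdg S (.obj o) k} (h : Derives T Θ Δ (.jdg K))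
    (hστ : IsEqSubst T Θ Θ idInst idInst Δ Γ σ τ) {s t : Fin k → TmExpr S 0}
    (hs : ∀ j, Derives T Θ Γ (.jdg (.ofTy (s j) ((K.bdry.act idInst σ).argType s j))))
    (ht : ∀ j, Derives T Θ Γ (.jdg (.ofTy (t j) ((K.bdry.act idInst σ).argType s j))))
    (hst : ∀ j, Derives T Θ Γ (.jdg (.eqTm (s j) (t j) ((K.bdry.act idInst σ).argType s j)))) :
    Derives T Θ Γ (.jdg (((K.bdry.act idInst σ).thesis.subst s).toBdry.fillEq
      ((K.head.act idInst σ).subst s) ((K.head.act idInst τ).subst t))) := by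
  induction k generalizing Δ σ τ with
  | zero =>
    have e : s = Expr.bvar := funext fun i => i.elim0
    have e' : t = Expr.bvar := funext fun i => i.elim0
    rw [e, e', Expr.subst_bvar, Expr.subst_bvar, BdryThesis.subst_bvar, ← Bdry.eq_toBdry]
    exact h.substEq hστ
  | succ k ih =>
    obtain ⟨hK, hA, a, ha, h⟩ := h.abstr_inv
    have hs0 := hs 0
    have ht0 := ht 0
    have hst0 := hst 0
    rw [Bdry.argType_zero] at hs0 ht0 hst0
    have hAA := Form.actEq_isTy.1 (hA.substEq hστ)
    -- The second argument is given at the type moved by `σ`, while `IsEqSubst` wants it at the type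
    -- moved by `τ`.
    have hG := hστ.extend ha hA.valid.2.2.2 hs0 (ht0.convTm hAA) hst0
    have eB : (K.openVar a).bdry.act idInst (Function.update σ a (s 0)) =
        (K.bdry.act idInst σ).openTm (s 0) := Bdry.act_openVar _ _ hK.1 ha _
    have eh (ρ : ℕ → TmExpr S 0) (w : TmExpr S 0) :
        (K.openVar a).head.act idInst (Function.update ρ a w) =
        (K.head.act idInst ρ).openTm w := Expr.act_openVar _ _ hK.2 ha _
    have := ih h hG (s := fun j => s j.succ) (t := fun j => t j.succ)
    simp only [eB, eh, Bdry.argType_openTm] at this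
    have := this (fun j => hs j.succ) (fun j => ht j.succ) (fun j => hst j.succ)
    simpa only [Bdry.openTm, BdryThesis.subst_openTm, Expr.subst_openTm] using this

/-! ## Instantiations -/

/-- `I` is a derivable instantiation of `Ξ` over `Θ; Γ`. -/
def IsInst (T : RawTheory.{u, v} S) (Ξ Θ : MCtx S) (Γ : VCtx S) (I : Inst S) : Prop :=
  ∀ c k M (B : Bdry S c k), ⟨c, k, M, B⟩ ∈ Ξ → Derives T Θ Γ (.jdg ((B.inst I).fill (I c k M)))

theorem IsInst.weaken {Ξ Θ : MCtx S} {Γ Γ' : VCtx S} {I : Inst S} (h : IsInst T Ξ Θ Γ I)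
    (hΓ : Γ'.Valid Θ) (hs : Γ ⊆ Γ') : IsInst T Ξ Θ Γ' I :=
  fun c k M B hM => (h c k M B hM).weaken hΓ hs

theorem Derives.act {Ξ Θ : MCtx S} {I : Inst S} {Δ Γ : VCtx S} {σ : ℕ → TmExpr S 0} {F : Form S}
    (h : Derives T Ξ Δ F) (hΓ : IsVCtx T Θ Γ) (hI : IsInst T Ξ Θ Γ I)
    (hσ : IsSubst T Ξ Θ I Δ Γ σ) : Derives T Θ Γ (F.act I σ) := by
  refine h.act_of (fun h => h)
    (fun Δ Γ σ => IsSubst T Ξ Θ I Δ Γ σ ∧ IsVCtx T Θ Γ ∧ IsInst T Ξ Θ Γ I)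
    ?_ ?_ ?_ ?_ ?_ ?_ ⟨hσ, hΓ, hI⟩
  · exact fun hG => ⟨hG.1.mctx, hG.1.target⟩
  · exact fun hG c k M ⟨B, hM⟩ => (hG.2.2 c k M B hM).valid.2.2.2
  · exact fun hG => hG.1.var
  · intro Δ Γ σ ⟨hσ, hΓ, hI⟩ a b A ha hb hA hA'
    have hΓ' := hΓ.cons hA' hb
    exact ⟨hσ.lift ha hb hA hA', hΓ', hI.weaken hΓ'.valid (List.subset_cons_self _ _)⟩
  · intro Δ Γ σ ⟨hσ, hΓ, hI⟩ c k M B t hM ht hB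
    exact (hI c k M B hM).substArgs ht
  · intro Δ Γ σ ⟨hσ, hΓ, hI⟩ o k M B s t hM hs ht hst hC
    -- The premises type `t j` at a type depending on `t`, but `Derives.substArgsEq` wants the type
    -- depending on `s`. Presuppositivity of the equation provides it, which is where
    -- well-formedness of `Γ` enters.
    have ht' (j) := ((hst j).presup hΓ).components.2.2
    have := (hI _ k M B hM).substArgsEq (.id hσ.mctx hσ.target) (s := s) (t := t)
    simp only [Bdry.fill, Bdry.act_id, Expr.act_id] at this
    exact this hs ht' hst

/-- `I` and `J` are judgementally equal derivable instantiations of `Ξ` over `Θ; Γ`. -/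
structure IsEqInst (T : RawTheory.{u, v} S) (Ξ Θ : MCtx S) (Γ : VCtx S) (I J : Inst S) : Prop where
  mctx : Θ.Valid
  vctx : IsVCtx T Θ Γ
  left : IsInst T Ξ Θ Γ I
  right : IsInst T Ξ Θ Γ J
  eq : ∀ o k M (B : Bdry S (.obj o) k), ⟨.obj o, k, M, B⟩ ∈ Ξ →
    Derives T Θ Γ (.jdg ((B.inst I).fillEq (I (.obj o) k M) (J (.obj o) k M)))

theorem IsEqInst.cons {Ξ Θ : MCtx S} {Γ : VCtx S} {I J : Inst S} (h : IsEqInst T Ξ Θ Γ I J)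
    {a : ℕ} {A : TyExpr S 0} (hΓ : IsVCtx T Θ ((a, A) :: Γ)) :
    IsEqInst T Ξ Θ ((a, A) :: Γ) I J :=
  have hs := List.subset_cons_self _ _
  ⟨h.mctx, hΓ, h.left.weaken hΓ.valid hs, h.right.weaken hΓ.valid hs,
    fun o k M B hM => (h.eq o k M B hM).weaken hΓ.valid hs⟩

theorem Derives.actEq {Ξ Θ : MCtx S} {I J : Inst S} {Δ Γ : VCtx S} {σ τ : ℕ → TmExpr S 0}
    {F : Form S} (h : Derives T Ξ Δ F) (hIJ : IsEqInst T Ξ Θ Γ I J)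
    (hστ : IsEqSubst T Ξ Θ I J Δ Γ σ τ) : F.ActEq T Θ I J Γ σ τ := by
  refine h.actEq_of (fun Γ => IsEqInst T Ξ Θ Γ I J) ?_ (fun hIJ hσ h => h.act hIJ.vctx hIJ.left hσ)
    (fun hIJ hσ h => h.act hIJ.vctx hIJ.right hσ) ?_ hIJ hστ
  · exact fun h _ _ hb hA => h.cons (h.vctx.cons hA hb)
  · intro Γ h o k M B s t hM hs ht hst hC
    have hM' := h.eq o k M B hM
    have ht' (j) := ((hst j).presup h.vctx).components.2.2
    -- The equation is `(I M)(s) ≡ (J M)(s) ≡ (J M)(t)`. Typing `J M` in the `I`-instance of its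
    -- boundary puts both parts over the same boundary.
    have h₁ : Derives _ _ _ _ := hM'.substArgs hs
    have h₂ := (hM'.fill_of_fillEq h.vctx).2.substArgsEq (.id h.mctx h.vctx.valid) (s := s) (t := t)
    simp only [Bdry.fill, Bdry.act_id, Expr.act_id] at h₂
    simp only [Bdry.fillEq, BdryThesis.subst_eqBdry] at h₁
    exact Derives.fillEq_trans h₁ (h₂ hs ht' hst)

/-- This is the identity substitution: in the new context `a` has type `B`, and converts back to
`A`. -/
theorem Derives.conv_ctx {Θ : MCtx S} {Γ : VCtx S} {a : ℕ} {A B : TyExpr S 0} {F : Form S}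
    (h : Derives T Θ ((a, A) :: Γ) F) (hAB : Derives T Θ Γ (.jdg (.eqTy A B))) :
    Derives T Θ ((a, B) :: Γ) F := by
  have hv := h.valid.2.1
  have hΓ : VCtx.Valid Θ ((a, B) :: Γ) := hv.1.cons hv.2.1 hAB.valid.2.2.1.2.2
  rw [← F.act_id]
  refine h.subst ⟨h.valid.1, hv, hΓ, fun {c C} hC => ?_⟩
  rw [Expr.act_id]
  rcases List.mem_cons.1 hC with e | hC
  · cases e
    exact (Derives.var h.valid.1 hΓ List.mem_cons_self).convTm
      (hAB.weaken hΓ (List.subset_cons_self _ _)).eqTySymm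
  · exact .var h.valid.1 hΓ (List.mem_cons_of_mem _ hC)

/-- Conversion of a judgement along the equality of two instances of its boundary. -/
theorem Derives.conv_bdry {Ξ Θ : MCtx S} {I J : Inst S} {Δ Γ : VCtx S} {σ τ : ℕ → TmExpr S 0}
    {c : Cls} {k : ℕ} {B : Bdry S c k} (hB : Derives T Ξ Δ (.bdry B))
    (hIJ : IsEqInst T Ξ Θ Γ I J) (hστ : IsEqSubst T Ξ Θ I J Δ Γ σ τ) {e : Expr S c k}
    (h : Derives T Θ Γ (.jdg ((B.act I σ).fill e))) :
    Derives T Θ Γ (.jdg ((B.act J τ).fill e)) := by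
  induction k generalizing Δ Γ σ τ with
  | zero =>
    have ty {A : TyExpr S 0} (hA : Derives T Ξ Δ (.jdg (.isTy A))) :=
      Form.actEq_isTy.1 (hA.actEq hIJ hστ)
    have tm {s : TmExpr S 0} {A : TyExpr S 0} (hs : Derives T Ξ Δ (.jdg (.ofTy s A))) :=
      Form.actEq_ofTy.1 (hs.actEq hIJ hστ)
    rw [B.eq_toBdry] at hB h ⊢
    have hb := hB.components
    rw [BdryThesis.toBdry_act] at h ⊢
    generalize B.thesis = b at hb h
    cases b with
    | isTy => exact h
    | ofTy A => exact h.convTm (ty hb)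
    | eqTy A A' =>
      cases e
      -- The chain runs from the `J`-instance of the left side through the two `I`-instances to the
      -- `J`-instance of the right side.
      exact ((ty hb.1).eqTySymm.eqTyTrans h).eqTyTrans (ty hb.2)
    | eqTm s t A =>
      cases e
      exact (((tm hb.2.1).eqTmSymm.eqTmTrans h).eqTmTrans (tm hb.2.2)).convEqTm (ty hb.1)
  | succ k ih =>
    obtain ⟨hBv, hA, a, ha, hB'⟩ := hB.bdryAbstr_inv
    obtain ⟨hv, hAI, b, hb, h'⟩ := h.abstr_inv
    have hAA := Form.actEq_isTy.1 (hA.actEq hIJ hστ)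
    have hAJ := hA.act hIJ.vctx hIJ.right hστ.right
    rw [Form.act, Jdg.act_isTy] at hAJ
    -- The result is abstracted over the `J`-instance of the type. The given derivation, where the
    -- variable has the `I`-instance as its type, is moved to this context by `Derives.conv_ctx`.
    have hΓ := hIJ.vctx.cons hAJ hb
    have hs := List.subset_cons_self (b, B.headType.act J τ) Γ
    have hAA' := hAA.weaken hΓ.valid hs
    have hG := (hστ.weaken hΓ.valid hs).extend_fvar ha hA.valid.2.2.2
      ((Derives.var hIJ.mctx hΓ.valid List.mem_cons_self).convTm hAA'.eqTySymm) hAA'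
    have := ih hB' (hIJ.cons hΓ) hG (e := e.openVar b) (by
      rw [Bdry.act_openVar I σ hBv ha]
      exact h'.conv_ctx hAA)
    rw [Bdry.act_openVar J τ hBv ha] at this
    exact .abstr ⟨(hB.act hIJ.vctx hIJ.right hστ.right).valid.2.2, hv.2⟩ hAJ hb this

/-! ## Finitary theories -/

theorem IsMCtx.valid {Θ : MCtx S} (h : IsMCtx T Θ) : Θ.Valid := by
  induction h with
  | nil => trivial
  | cons _ hB he ih => exact ⟨ih, he, hB.valid.2.2⟩

theorem IsMCtx.weaken_theory {T T' : RawTheory.{u, v} S}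
    (hT : ∀ {c : Cls} {R : RawRule S c}, T.HasRule R → T'.HasRule R) {Θ : MCtx S}
    (h : IsMCtx T Θ) : IsMCtx T' Θ := by
  induction h with
  | nil => exact .nil
  | cons _ hB he ih => exact .cons ih (hB.weaken_theory hT) he

/-- Derivability is monotone in the theory, and the preceding rules are among those of `T`. -/
theorem RawTheory.IsFinitary.finitaryOver (hT : T.IsFinitary) {c : Cls} {R : RawRule S c}
    (hR : T.HasRule R) : R.FinitaryOver T := by
  obtain ⟨r, -, -, h⟩ := hT
  obtain ⟨i, hi⟩ := hR
  have h := h i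
  rw [hi] at h
  have hT' {c : Cls} {R : RawRule S c} (hR : (T.restrict fun j => r j i).HasRule R) :
      T.HasRule R := hR.imp' Subtype.val fun _ h => h
  exact ⟨h.1.weaken_theory hT', h.2.weaken_theory hT'⟩

/-- Instantiations of a well-formed metavariable context are derivable and judgementally equal as
soon as their values are judgementally equal. -/
theorem IsEqInst.of_eq {Ξ Θ : MCtx S} {Γ : VCtx S} {I J : Inst S} (hΞ : IsMCtx T Ξ)
    (hΘ : Θ.Valid) (hΓ : IsVCtx T Θ Γ)
    (h_eqn : ∀ o k M (B : Bdry S (.eqn o) k), ⟨.eqn o, k, M, B⟩ ∈ Ξ →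
      Derives T Θ Γ (.jdg ((B.inst I).fill (I (.eqn o) k M))))
    (h_obj : ∀ o k M (B : Bdry S (.obj o) k), ⟨.obj o, k, M, B⟩ ∈ Ξ →
      Derives T Θ Γ (.jdg ((B.inst I).fillEq (I (.obj o) k M) (J (.obj o) k M)))) :
    IsEqInst T Ξ Θ Γ I J := by
  induction hΞ with
  | nil => exact ⟨hΘ, hΓ, fun _ _ _ _ h => (nomatch h), fun _ _ _ _ h => (nomatch h), h_obj⟩
  | @cons Ξ e hΞ hB he ih =>
    have ih := ih (fun o k M B hM => h_eqn o k M B (List.mem_cons_of_mem _ hM))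
      fun o k M B hM => h_obj o k M B (List.mem_cons_of_mem _ hM)
    -- Boundaries of premises are derived in the empty variable context, so there is nothing to
    -- substitute.
    have hστ : IsEqSubst T Ξ Θ I J [] Γ .fvar .fvar :=
      ⟨⟨hΘ, trivial, hΓ.valid, fun h => by cases h⟩, ⟨hΘ, trivial, hΓ.valid, fun h => by cases h⟩,
        fun h => by cases h⟩
    obtain ⟨c, k, M, B⟩ := e
    have conv {e : Expr S c k} (h : Derives T Θ Γ (.jdg ((B.inst I).fill e))) :
        Derives T Θ Γ (.jdg ((B.inst J).fill e)) := by
      rw [← Bdry.act_fvar] at h ⊢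
      exact hB.conv_bdry ih hστ h
    have key : Derives T Θ Γ (.jdg ((B.inst I).fill (I c k M))) ∧
        Derives T Θ Γ (.jdg ((B.inst J).fill (J c k M))) := by
      cases c with
      | obj o =>
        have h := (h_obj o k M B List.mem_cons_self).fill_of_fillEq hΓ
        exact ⟨h.1, conv h.2⟩
      | eqn o =>
        have h := h_eqn o k M B List.mem_cons_self
        -- An equality metavariable has `⋆` as its value under both instantiations, so only the
        -- boundary has to be converted.
        exact ⟨h, conv (Subsingleton.elim (I (.eqn o) k M) (J (.eqn o) k M) ▸ h)⟩
    refine ⟨hΘ, hΓ, fun c k M B hM => ?_, fun c k M B hM => ?_, h_obj⟩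
    · rcases List.mem_cons.1 hM with e | hM
      · cases e; exact key.1
      · exact ih.left c k M B hM
    · rcases List.mem_cons.1 hM with e | hM
      · cases e; exact key.2
      · exact ih.right c k M B hM

end FTT

/-! ### The economic congruence rule -/

theorem mainTheorem7 {S : Signature.{u}} (T : RawTheory.{u, v} S) (hT : T.IsFinitary)
    {o : Kind} (R : RawRule S (.obj o)) (hR : T.HasRule R)
    (Θ : MCtx S) (Γ : VCtx S) (hΘ : IsMCtx T Θ) (hΓ : IsVCtx T Θ Γ)
    (I J : Inst S) (hI : I.Valid R.prem Θ Γ) (hJ : J.Valid R.prem Θ Γ)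
    (h_eqn : ∀ o' k M (B : Bdry S (.eqn o') k), ⟨.eqn o', k, M, B⟩ ∈ R.prem →
      Derives T Θ Γ (.jdg ((B.inst I).fill (I (.eqn o') k M))))
    (h_obj : ∀ o' k M (B : Bdry S (.obj o') k), ⟨.obj o', k, M, B⟩ ∈ R.prem →
      Derives T Θ Γ (.jdg ((B.inst I).fillEq (I (.obj o') k M) (J (.obj o') k M)))) :
    Derives T Θ Γ (.jdg ((R.bdry.inst I).toBdry.fillEq (R.head.inst I) (R.head.inst J))) := by
  obtain ⟨hΞ, hb⟩ := hT.finitaryOver hR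
  have h := IsEqInst.of_eq hΞ hΘ.valid hΓ h_eqn h_obj
  refine .congr hΘ.valid hΓ.valid hR h.left h.right h_obj fun C hC => ?_
  -- The remaining premise, the equality of the two instances of the type, comes from the
  -- derivability of the boundary of the conclusion over the premises.
  have := hb.actEq (σ := .fvar) (τ := .fvar) h
    ⟨⟨hΘ.valid, trivial, hΓ.valid, fun h => by cases h⟩,
      ⟨hΘ.valid, trivial, hΓ.valid, fun h => by cases h⟩, fun h => by cases h⟩ C hC
  rwa [Expr.act_fvar, Expr.act_fvar] at this
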